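/- **Definitions.** A *Cartan scheme of rank two* $\mathcal C$ consists of the index set $I=\{1,2\}$, a non-empty set $A$ of objects, maps $\rho_i:A\to A$ with $\rho_i^2=\mathrm{id}$ ($i\in I$), and for each $a\in A$ a generalized Cartan matrix $C^a=(c^a_{ij})_{i,j\in I}\in\mathbb Z^{I\times I}$ (that is, $c^a_{ii}=2$, $c^a_{ij}\le 0$ for $i\neq j$, and $c^a_{ij}=0\Rightarrow c^a_{ji}=0$), such that $c^a_{ij}=c^{\rho_i(a)}_{ij}$ for all $a,i,j$. Two Cartan schemes are *equivalent* if there are bijections between their index sets and between their sets of objects which are compatible with the maps $\rho_i$ and the entries $c^a_{ij}$. The scheme is *irreducible* if every $C^a$ is indecomposable. Let $\alpha_1,\alpha_2$ be the standard basis of $\mathbb Z^I=\mathbb Z^2$ and let $\sigma_i^a(\alpha_j)=\alpha_j-c^a_{ij}\alpha_i$. For $a,b\in A$ let $\mathrm{Hom}(a,b)$ be the set of linear maps $\sigma_{i_k}\cdots\sigma_{i_2}\sigma_{i_1}^a$ with $k\ge 0$ and $\rho_{i_k}\cdots\rho_{i_1}(a)=b$, where each factor is taken at the object reached so far. The scheme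 is *connected* if $\mathrm{Hom}(a,b)\ne\emptyset$ for all $a,b\in A$, and *simply connected* if $|\mathrm{Hom}(a,a)|=1$ for all $a\in A$. The set of *real roots* at $a$ is $R^a=\{\varphi(\alpha_i)\mid i\in I,\ b\in A,\ \varphi\in\mathrm{Hom}(b,a)\}$, and $R^a_+=R^a\cap\mathbb N_0^2$. The real roots form a *finite root system* (of type $\mathcal C$) if all $R^a$ are finite and, for all $a\in A$ and $i\in I$: $R^a=R^a_+\cup -R^a_+$; $R^a\cap\mathbb Z\alpha_i=\{\alpha_i,-\alpha_i\}$; $\sigma_i^a(R^a)=R^{\rho_i(a)}$; and $(\rho_i\rho_j)^{m}(a)=a$ for $j\ne i$, where $m=|R^a\cap(\mathbb N_0\alpha_i+\mathbb N_0\alpha_j)|$. *$\mathcal F$-sequences* are the finite sequences in $\mathbb N_0^2$ that are obtained from $((0,1),(1,1),(1,0))$ by repeatedly replacing a sequence $(v_1,\dots,v_n)$ by $(v_1,\dots,v_i,v_i+v_{i+1},v_{i+1},\dots,v_n)$ for some $1\le i\le n-1$. Write $(a,b)\le_{\mathbb Q}(c,d)$ if $ad\le cb$. **Proposition 3.7 (rsrank2).**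 (1) For each $\mathcal F$-sequence $f$ there is a connected simply connected Cartan scheme of rank two, unique up to equivalence, such that its real roots form a finite root system and the set of entries of $f$ is $R^a_+$ for some object $a$. (2) Conversely, let $\mathcal C$ be an irreducible Cartan scheme of rank two (not necessarily connected or simply connected) whose real roots form a finite root system, and let $a$ be an object of $\mathcal C$. Then the elements of $R^a_+$, each taken once, can be sorted in ascending order with respect to $\le_{\mathbb Q}$ in exactly one way, and the resulting sequence is an $\mathcal F$-sequence. -/

import Mathlib

universe u v

/-- Generalized Cartan matrices (in the sense of Kac): integral, `2` on the diagonal, nonpositive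
off the diagonal, with symmetric zero pattern. -/
structure IsGenCartanMatrix {I : Type*} (M : Matrix I I ℤ) : Prop where
  diag : ∀ i, M i i = 2
  nonpos : ∀ i j, i ≠ j → M i j ≤ 0
  zero : ∀ i j, M i j = 0 → M j i = 0

/-- A matrix is indecomposable if the index set is not a disjoint union of two non-empty sets
such that all entries with one index in each of them vanish. -/
def Matrix.IsIndecomposable {I : Type*} (M : Matrix I I ℤ) : Prop :=
  ¬ ∃ J : Set I, J.Nonempty ∧ Jᶜ.Nonempty ∧ ∀ i ∈ J, ∀ j ∈ Jᶜ, M i j = 0 ∧ M j i = 0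

/-- A Cartan scheme with index set `I` and set of objects `A`. Its rank is the cardinality
of `I`; the schemes of rank two are those with `I = Fin 2`, where `0`, `1 : Fin 2` play the role
of the indices `1`, `2`. -/
structure CartanScheme (I A : Type*) where
  /-- There is at least one object. -/
  nonempty : Nonempty A
  /-- The object changes `ρ_i : A → A`. -/
  rho : I → A → A
  /-- The Cartan matrices `C^a`. -/
  cartan : A → Matrix I I ℤ
  isGenCartanMatrix : ∀ a, IsGenCartanMatrix (cartan a)
  rho_rho : ∀ i a, rho i (rho i a) = a
  cartan_rho : ∀ a i j, cartan a i j = cartan (rho i a) i j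

/-- The inclusion of `ℕ₀^I` into `ℤ^I`. -/
def natVec {I : Type*} (v : I → ℕ) : I → ℤ := fun i => (v i : ℤ)

/-- The nonnegative part `S ∩ ℕ₀^I` of a subset `S` of `ℤ^I`, as a subset of `ℕ₀^I`. -/
def natPart {I : Type*} (S : Set (I → ℤ)) : Set (I → ℕ) := {v | natVec v ∈ S}

/-- The standard basis vector `α_i` of `ℤ^I`. -/
def simpleRoot {I : Type*} [DecidableEq I] (i : I) : I → ℤ := Pi.single i 1

namespace CartanScheme

/-- Two Cartan schemes are equivalent if there are bijections between their index sets and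
between their sets of objects compatible with object changes and Cartan matrices. -/
def Equivalent {I I' A A' : Type*} (C : CartanScheme I A) (C' : CartanScheme I' A') : Prop :=
  ∃ (e : I ≃ I') (g : A ≃ A'),
    (∀ i a, g (C.rho i a) = C'.rho (e i) (g a)) ∧
    ∀ a i j, C'.cartan (g a) (e i) (e j) = C.cartan a i j

/-- All Cartan matrices of `C` are indecomposable. -/
def Irreducible {I A : Type*} (C : CartanScheme I A) : Prop :=
  ∀ a, (C.cartan a).IsIndecomposable

section

variable {I : Type*} {A : Type*} [Fintype I] [DecidableEq I] (C : CartanScheme I A)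

/-- The reflection `σ_i^a` of `ℤ^I`, in coordinates: `v ↦ v - (∑ j, c^a_{ij} v_j) α_i`.
Its values on the basis are given in `reflection_simpleRoot`. -/
def reflection (i : I) (a : A) : (I → ℤ) →ₗ[ℤ] (I → ℤ) where
  toFun v := v - (∑ j, C.cartan a i j * v j) • simpleRoot i
  map_add' v w := by
    simp only [Pi.add_apply, mul_add, Finset.sum_add_distrib, add_smul]
    abel
  map_smul' r v := by
    have h : ∀ j, C.cartan a i j * (r * v j) = r * (C.cartan a i j * v j) := fun j => by ring
    simp only [Pi.smul_apply, smul_eq_mul, RingHom.id_apply, smul_sub, smul_smul, h,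
      ← Finset.mul_sum]

theorem reflection_simpleRoot (i j : I) (a : A) :
    C.reflection i a (simpleRoot j) = simpleRoot j - C.cartan a i j • simpleRoot i := by
  simp [reflection, simpleRoot, Pi.single_apply]

/-- `C.IsMorphism a b f` says that the linear map `f` is a morphism from `a` to `b` in the Weyl
groupoid of `C`, that is, `f = σ_{i_k} ⋯ σ_{i_2} σ_{i_1}^a` with `b = ρ_{i_k} ⋯ ρ_{i_1}(a)`. -/
inductive IsMorphism (a : A) : A → ((I → ℤ) →ₗ[ℤ] (I → ℤ)) → Prop
  | id : IsMorphism a a LinearMap.id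
  | step (i : I) (b : A) (f : (I → ℤ) →ₗ[ℤ] (I → ℤ)) (h : IsMorphism a b f) :
      IsMorphism a (C.rho i b) (C.reflection i b ∘ₗ f)

/-- The set `Hom(a, b)` of the Weyl groupoid. -/
def homSet (a b : A) : Set ((I → ℤ) →ₗ[ℤ] (I → ℤ)) := {f | C.IsMorphism a b f}

/-- The Weyl groupoid is connected. -/
def Connected : Prop := ∀ a b, (C.homSet a b).Nonempty

/-- `|End(a)| = 1` for all objects `a`. -/
def SimplyConnected : Prop := ∀ a, (C.homSet a a).encard = 1

/-- The set `R^a` of real roots at `a`. -/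
def realRoots (a : A) : Set (I → ℤ) :=
  {x | ∃ (b : A) (f : (I → ℤ) →ₗ[ℤ] (I → ℤ)) (i : I), f ∈ C.homSet b a ∧ x = f (simpleRoot i)}

/-- The set `R^a ∩ ℕ₀^I` of positive real roots at `a`. -/
def posRoots (a : A) : Set (I → ℕ) := natPart (C.realRoots a)

/-- `R^a ∩ (ℕ₀ α_i + ℕ₀ α_j)`; its cardinality is the number `m^a_{ij}`. -/
def rootsSpannedBy (R : A → Set (I → ℤ)) (a : A) (i j : I) : Set (I → ℤ) :=
  {x ∈ R a | ∃ p q : ℕ, x = (p : ℤ) • simpleRoot i + (q : ℤ) • simpleRoot j}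

/-- `(R^a)_{a ∈ A}` is a root system of type `C`. -/
structure IsRootSystem (R : A → Set (I → ℤ)) : Prop where
  pos_neg : ∀ a, R a = natVec '' natPart (R a) ∪ (fun v => -natVec v) '' natPart (R a)
  reduced : ∀ a i, {x ∈ R a | ∃ k : ℤ, x = k • simpleRoot i} = {simpleRoot i, -simpleRoot i}
  refl : ∀ a i, C.reflection i a '' R a = R (C.rho i a)
  coxeter : ∀ a i j, i ≠ j → (rootsSpannedBy R a i j).Finite →
    (fun x => C.rho i (C.rho j x))^[(rootsSpannedBy R a i j).ncard] a = a

/-- The real roots form a finite root system of type `C`. -/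
def HasFiniteRealRootSystem : Prop :=
  C.IsRootSystem C.realRoots ∧ ∀ a, (C.realRoots a).Finite

end

end CartanScheme

/-- The sequences obtained from `((0,1),(1,1),(1,0))` by repeatedly inserting between two
neighbours their sum. -/
inductive IsFSequence : List (Fin 2 → ℕ) → Prop
  | base : IsFSequence [![0, 1], ![1, 1], ![1, 0]]
  | insert (l r : List (Fin 2 → ℕ)) (x y : Fin 2 → ℕ) (h : IsFSequence (l ++ x :: y :: r)) :
      IsFSequence (l ++ x :: (x + y) :: y :: r)

/-- `(a,b) ≤ (c,d)` if and only if `ad ≤ cb`. -/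
def leQ (x y : Fin 2 → ℕ) : Prop := x 0 * y 1 ≤ y 0 * x 1

/-- `l` lists the elements of `S`, each exactly once, in ascending order with respect to `leQ`. -/
def IsAscendingListing (S : Set (Fin 2 → ℕ)) (l : List (Fin 2 → ℕ)) : Prop :=
  {x | x ∈ l} = S ∧ l.Nodup ∧ l.Pairwise leQ

/-- `C` is connected and simply connected, its real roots form a finite root system, and at some
object the set of positive roots is the set of entries of `f`. -/
def Realizes {A : Type*} (C : CartanScheme (Fin 2) A) (f : List (Fin 2 → ℕ)) : Prop :=
  C.Connected ∧ C.SimplyConnected ∧ C.HasFiniteRealRootSystem ∧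
    ∃ a, C.posRoots a = {x | x ∈ f}

/-!
Both parts rest on following the real roots at an object once around the plane. Walk from an object
`a` by applying the two object changes alternately. The morphisms from the objects of the walk to
`a` send the simple roots to pairs `-β_k`, `β_{k+1}`, where `β_0 = -α₀`, `β_1 = α₁` and
`β_{k+2} + β_k = c • β_{k+1}` with `-c` a Cartan entry of the `k`-th object. Consecutive `β_k`
have determinant one, and since all roots at the `k`-th object are positive or negative, no root
lies strictly between `β_k` and `β_{k+1}`. So `β_{k+1}` is the only possible successor of `β_k`
(`IsNext.unique`), and the set of roots at `a` determines the whole sequence. Finiteness forces the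
sequence to arrive at `α₀` after some number `n` of steps (`exists_isHalfTurn`). By then all
positive roots have been passed in ascending order, and from there on the sequence repeats with
opposite sign.

For an irreducible scheme `n ≥ 3`, so the positive roots form a sequence from `(0,1)` to `(1,0)`
with consecutive determinants one. These are exactly the `ℱ`-sequences
(`IsFSequence.isUnimodularPath`, `IsUnimodularPath.isFSequence`): at a first local maximum of the
height `v ↦ v 0 + v 1` the entry is the sum of its neighbours and can be removed.

Uniqueness in the first part: the vectors `β_k` determine the Cartan entries along the walk. In a
connected scheme the walk meets every object, and if the scheme is simply connected, the Coxeter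
relation shows that objects of the walk agree precisely when their indices agree modulo `2n`
(`IsHalfTurn.walk_eq_iff`). Existence: extend the given sequence to `ℤ` by `w (k + n) = -w k`, and
take as objects the `2n` bases `-w (k - 1)`, `w k` of the plane, arranged in a circle. Reflections
become changes of coordinates between neighbouring bases (`reflection_chamberCoords`), so the real
roots at an object are the coordinates of the vectors `w m`.
-/

/-! ### Determinants of plane vectors -/


/-- The determinant `x₁ y₀ - x₀ y₁`. On `ℕ₀²` it is positive if and only if `x` strictly precedes
`y` with respect to `leQ`. -/
def slopeDet (x y : Fin 2 → ℤ) : ℤ := y 0 * x 1 - x 0 * y 1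

theorem slopeDet_self (x : Fin 2 → ℤ) : slopeDet x x = 0 := by simp [slopeDet]

theorem slopeDet_swap (x y : Fin 2 → ℤ) : slopeDet x y = -slopeDet y x := by
  simp only [slopeDet]; ring

theorem slopeDet_neg_left (x y : Fin 2 → ℤ) : slopeDet (-x) y = -slopeDet x y := by
  simp only [slopeDet, Pi.neg_apply]; ring

theorem slopeDet_neg_right (x y : Fin 2 → ℤ) : slopeDet x (-y) = -slopeDet x y := by
  simp only [slopeDet, Pi.neg_apply]; ring

theorem slopeDet_smul_left (r : ℤ) (x y : Fin 2 → ℤ) : slopeDet (r • x) y = r * slopeDet x y := by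
  simp only [slopeDet, Pi.smul_apply, smul_eq_mul]; ring

theorem slopeDet_smul_right (r : ℤ) (x y : Fin 2 → ℤ) : slopeDet x (r • y) = r * slopeDet x y := by
  simp only [slopeDet, Pi.smul_apply, smul_eq_mul]; ring

theorem slopeDet_add_right (x y z : Fin 2 → ℤ) :
    slopeDet x (y + z) = slopeDet x y + slopeDet x z := by
  simp only [slopeDet, Pi.add_apply]; ring

theorem slopeDet_add_left (x y z : Fin 2 → ℤ) :
    slopeDet (x + y) z = slopeDet x z + slopeDet y z := by
  simp only [slopeDet, Pi.add_apply]; ring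

theorem vec_ext {α : Type*} {x y : Fin 2 → α} (h0 : x 0 = y 0) (h1 : x 1 = y 1) : x = y := by
  ext i; fin_cases i <;> assumption

/-- Cramer's rule for a basis `u, v` of determinant one. -/
theorem eq_of_slopeDet_eq_one {u v : Fin 2 → ℤ} (h : slopeDet u v = 1) (x : Fin 2 → ℤ) :
    x = slopeDet u x • v - slopeDet v x • u := by
  simp only [slopeDet] at *
  refine vec_ext ?_ ?_ <;> simp only [Pi.sub_apply, Pi.smul_apply, smul_eq_mul] <;>
    linear_combination (-1 : ℤ) * (x _) * h

theorem eq_of_slopeDet_eq {u v x y : Fin 2 → ℤ} (h : slopeDet u v = 1)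
    (hu : slopeDet u x = slopeDet u y) (hv : slopeDet v x = slopeDet v y) : x = y := by
  rw [eq_of_slopeDet_eq_one h x, eq_of_slopeDet_eq_one h y, hu, hv]

/-- The outer two of three vectors with consecutive determinants one add up to an integral
multiple of the middle one. -/
theorem add_eq_slopeDet_smul {u v w : Fin 2 → ℤ} (h : slopeDet u v = 1) (h' : slopeDet v w = 1) :
    u + w = slopeDet u w • v := by
  refine eq_of_slopeDet_eq h ?_ ?_
  · rw [slopeDet_add_right, slopeDet_self, slopeDet_smul_right, h]; ring
  · rw [slopeDet_add_right, slopeDet_swap v u, slopeDet_smul_right, slopeDet_self, h, h']; ring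

/-- The strict version of `leQ`. -/
def ltQ (x y : Fin 2 → ℕ) : Prop := x 0 * y 1 < y 0 * x 1

theorem ltQ_iff (x y : Fin 2 → ℕ) : ltQ x y ↔ 0 < slopeDet (natVec x) (natVec y) := by
  simp only [ltQ, slopeDet, natVec, sub_pos]; norm_cast

theorem ltQ.trans {x y z : Fin 2 → ℕ} (h : ltQ x y) (h' : ltQ y z) : ltQ x z := by
  unfold ltQ at *
  have a1 : 0 < y 0 := Nat.pos_of_ne_zero fun e => by simp [e] at h
  have a2 : 0 < y 1 := Nat.pos_of_ne_zero fun e => by simp [e] at h'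
  have b : (x 0 * y 1) * (y 0 * z 1) < (y 0 * x 1) * (z 0 * y 1) := Nat.mul_lt_mul'' h h'
  refine lt_of_mul_lt_mul_right ?_ (Nat.zero_le (y 0 * y 1))
  calc _ = (x 0 * y 1) * (y 0 * z 1) := by ring
    _ < _ := b
    _ = _ := by ring

instance : IsTrans (Fin 2 → ℕ) ltQ := ⟨fun _ _ _ => ltQ.trans⟩

/-- Two vectors with determinant one, in ascending order. -/
def Adjacent (x y : Fin 2 → ℕ) : Prop := y 0 * x 1 = x 0 * y 1 + 1

theorem adjacent_iff (x y : Fin 2 → ℕ) : Adjacent x y ↔ slopeDet (natVec x) (natVec y) = 1 := by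
  simp only [Adjacent, slopeDet, natVec, sub_eq_iff_eq_add']; norm_cast

theorem Adjacent.ltQ {x y : Fin 2 → ℕ} (h : Adjacent x y) : ltQ x y := by
  unfold Adjacent at h; unfold _root_.ltQ; omega

theorem Adjacent.add_left {x y : Fin 2 → ℕ} (h : Adjacent x y) : Adjacent x (x + y) := by
  simp only [Adjacent, Pi.add_apply] at *; linarith

theorem Adjacent.add_right {x y : Fin 2 → ℕ} (h : Adjacent x y) : Adjacent (x + y) y := by
  simp only [Adjacent, Pi.add_apply] at *; linarith

theorem Adjacent.of_add {x y : Fin 2 → ℕ} (h : Adjacent x (x + y)) : Adjacent x y := by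
  simp only [Adjacent, Pi.add_apply] at *; linarith

/-! ### Characterisation of `ℱ`-sequences -/

/-- A sequence from `(0,1)` to `(1,0)` with at least three entries, in which all determinants of
consecutive entries are one. -/
structure IsUnimodularPath (l : List (Fin 2 → ℕ)) : Prop where
  chain : l.IsChain Adjacent
  three_le : 3 ≤ l.length
  head : l.head? = some ![0, 1]
  last : l.getLast? = some ![1, 0]

theorem IsUnimodularPath.pairwise {l : List (Fin 2 → ℕ)} (h : IsUnimodularPath l) :
    l.Pairwise ltQ :=
  List.isChain_iff_pairwise.1 (h.chain.imp fun _ _ => Adjacent.ltQ)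

theorem IsFSequence.isUnimodularPath {l : List (Fin 2 → ℕ)} (h : IsFSequence l) :
    IsUnimodularPath l := by
  induction h with
  | base => exact ⟨by simp [Adjacent], by simp, rfl, rfl⟩
  | insert l r x y h ih =>
    obtain ⟨h1, h2, h3, h4⟩ := ih
    refine ⟨?_, ?_, ?_, ?_⟩
    · rw [List.isChain_append_cons_cons] at h1 ⊢
      exact ⟨h1.1, h1.2.1.add_left, List.isChain_cons_cons.2 ⟨h1.2.1.add_right, h1.2.2⟩⟩
    · simp at h2 ⊢; omega
    · cases l <;> simpa using h3
    · simpa using h4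

/-- Following an ascent of the height `v 0 + v 1`, one arrives at a local maximum; it is the sum of
its two neighbours. -/
theorem exists_sum_of_ascent (r : List (Fin 2 → ℕ)) : ∀ x y : Fin 2 → ℕ,
    (x :: y :: r).IsChain Adjacent → x 0 + x 1 < y 0 + y 1 →
    (x :: y :: r).getLast? = some ![1, 0] →
    ∃ (L R : List (Fin 2 → ℕ)) (u v : Fin 2 → ℕ), x :: y :: r = L ++ u :: (u + v) :: v :: R := by
  induction r with
  | nil =>
    intro x y hc hlt hl
    simp only [List.getLast?_cons_cons, List.getLast?_singleton, Option.some.injEq] at hl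
    subst hl
    simp [Adjacent] at hc hlt
    omega
  | cons z r ih =>
    intro x y hc hlt hl
    have hc' := (List.isChain_cons_cons.1 hc)
    by_cases hyz : y 0 + y 1 < z 0 + z 1
    · obtain ⟨L, R, u, v, e⟩ := ih y z hc'.2 hyz (by simpa using hl)
      exact ⟨x :: L, R, u, v, by simp [e]⟩
    · have h1 := hc'.1
      have h2 := (List.isChain_cons_cons.1 hc'.2).1
      refine ⟨[], r, x, z, ?_⟩
      suffices y = x + z by rw [← this]; rfl
      rw [adjacent_iff] at h1 h2
      -- `x + z = c • y` with an integer `c`, and comparing heights gives `0 < c < 2`.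
      obtain ⟨c, hc⟩ : ∃ c : ℤ, natVec x + natVec z = c • natVec y :=
        ⟨_, add_eq_slopeDet_smul h1 h2⟩
      have c0 := congrFun hc 0
      have c1 := congrFun hc 1
      simp only [natVec, Pi.add_apply, Pi.smul_apply, smul_eq_mul] at c0 c1
      have hs : ((x 0 + x 1 : ℕ) : ℤ) + (z 0 + z 1 : ℕ) = c * (y 0 + y 1 : ℕ) := by
        push_cast; linarith
      have hx : 0 < x 0 + x 1 := by
        by_contra h0
        have e0 : x 0 = 0 := by omega
        have e1 : x 1 = 0 := by omega
        simp [slopeDet, natVec, e0, e1] at h1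
      have hc0 : 0 < c := by
        by_contra h0
        have : c * (y 0 + y 1 : ℕ) ≤ 0 := mul_nonpos_of_nonpos_of_nonneg (by omega) (by positivity)
        omega
      have hc2 : c < 2 := by
        by_contra h0
        have : 2 * ((y 0 + y 1 : ℕ) : ℤ) ≤ c * (y 0 + y 1 : ℕ) :=
          mul_le_mul_of_nonneg_right (by omega) (by positivity)
        omega
      obtain rfl : c = 1 := by omega
      refine vec_ext ?_ ?_ <;> simp only [Pi.add_apply] <;> omega

theorem IsUnimodularPath.isFSequence {l : List (Fin 2 → ℕ)} (h : IsUnimodularPath l) :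
    IsFSequence l := by
  obtain ⟨n, hn⟩ : ∃ n, l.length = n := ⟨_, rfl⟩
  induction n generalizing l with
  | zero => have := h.three_le; omega
  | succ n ih =>
    obtain ⟨hc, h3, hh, hl⟩ := h
    match l, h3 with
    | x :: y :: z :: r, h3 =>
    obtain rfl : x = ![0, 1] := by simpa using hh
    have h1 := (List.isChain_cons_cons.1 hc).1
    have h2 := (List.isChain_cons_cons.1 (List.isChain_cons_cons.1 hc).2).1
    have y0 : y 0 = 1 := by simpa [Adjacent] using h1
    have y1 : y 1 ≠ 0 := fun e => by simp [Adjacent, e] at h2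
    by_cases hr : r = []
    · subst hr
      obtain rfl : z = ![1, 0] := by simpa using hl
      have : y = ![1, 1] := vec_ext (by simpa using y0) (by simpa [Adjacent] using h2)
      rw [this]
      exact .base
    · obtain ⟨L, R, u, v, e⟩ := exists_sum_of_ascent (z :: r) ![0, 1] y hc (by simp; omega) hl
      rw [e] at hc h3 hh hl hn ⊢
      refine .insert L R u v (ih ⟨?_, ?_, ?_, ?_⟩ ?_)
      · rw [List.isChain_append_cons_cons] at hc ⊢
        exact ⟨hc.1, hc.2.1.of_add, (List.isChain_cons_cons.1 hc.2.2).2⟩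
      · have := congrArg List.length e
        have := List.length_pos_of_ne_nil hr
        simp at *; omega
      · cases L <;> simpa using hh
      · simpa using hl
      · simp at hn ⊢; omega

/-! ### Cyclic sequences of vectors -/

/-- A bi-infinite sequence of vectors running around the plane: `n` steps lead to the opposite
vector, the determinant of consecutive vectors is one, and within `n` steps the vectors turn
in one direction. -/
structure IsUnimodularCycle (n : ℕ) (w : ℤ → Fin 2 → ℤ) : Prop where
  three_le : 3 ≤ n
  antiperiodic : ∀ k, w (k + n) = -w k
  slopeDet_succ : ∀ k, slopeDet (w k) (w (k + 1)) = 1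
  slopeDet_pos : ∀ k m : ℤ, k < m → m < k + n → 0 < slopeDet (w k) (w m)

/-- The extension of a finite sequence of length `n` to `ℤ` that changes its sign after each
`n` steps. -/
def antiperiodicExtension (l : List (Fin 2 → ℕ)) (k : ℤ) : Fin 2 → ℤ :=
  ((k / l.length).negOnePow : ℤ) • natVec (l.getD (k % l.length).toNat 0)

theorem antiperiodicExtension_of_lt {l : List (Fin 2 → ℕ)} {k : ℕ} (hk : k < l.length) :
    antiperiodicExtension l k = natVec l[k] := by
  have h1 : (k : ℤ) / l.length = 0 := Int.ediv_eq_zero_of_lt (by positivity) (by exact_mod_cast hk)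
  have h2 : (k : ℤ) % l.length = k := Int.emod_eq_of_lt (by positivity) (by exact_mod_cast hk)
  simp [antiperiodicExtension, h1, h2, hk]

theorem antiperiodicExtension_add_length {l : List (Fin 2 → ℕ)} (hl : 0 < l.length) (k : ℤ) :
    antiperiodicExtension l (k + l.length) = -antiperiodicExtension l k := by
  have h1 : (k + l.length) / (l.length : ℤ) = k / l.length + 1 := by
    rw [Int.add_ediv_of_dvd_right (dvd_refl _), Int.ediv_self (by omega)]
  simp only [antiperiodicExtension, h1, Int.negOnePow_succ, Int.add_emod_right]
  simp

theorem antiperiodicExtension_mul_add {l : List (Fin 2 → ℕ)} (hl : 0 < l.length) (q : ℤ) {r : ℕ}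
    (hr : r < l.length) :
    antiperiodicExtension l (l.length * q + r) = (q.negOnePow : ℤ) • natVec l[r] := by
  have h1 : (l.length * q + r) / (l.length : ℤ) = q := by
    rw [Int.mul_add_ediv_left _ _ (by omega), Int.ediv_eq_zero_of_lt (by omega) (by omega),
      add_zero]
  have h2 : (l.length * q + r) % (l.length : ℤ) = r := by
    rw [Int.mul_add_emod_self_left, Int.emod_eq_of_lt (by omega) (by omega)]
  simp [antiperiodicExtension, h1, h2, hr]

theorem exists_eq_mul_add {n : ℕ} (hn : 0 < n) (k : ℤ) :
    ∃ (q : ℤ) (r : ℕ), r < n ∧ k = n * q + r := by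
  have h1 := Int.emod_nonneg k (b := n) (by omega)
  have h2 := Int.emod_lt_of_pos k (b := n) (by omega)
  exact ⟨k / n, (k % n).toNat, by omega, by rw [Int.toNat_of_nonneg h1, Int.mul_ediv_add_emod]⟩

theorem IsUnimodularPath.isUnimodularCycle {l : List (Fin 2 → ℕ)} (h : IsUnimodularPath l) :
    IsUnimodularCycle l.length (antiperiodicExtension l) := by
  have h3 := h.three_le
  have hl : 0 < l.length := by omega
  have hfirst : l[0] = ![0, 1] := by
    have := h.head
    rw [List.head?_eq_getElem?, List.getElem?_eq_getElem hl] at this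
    simpa using this
  have hlast : l[l.length - 1] = ![1, 0] := by
    have := h.last
    rw [List.getLast?_eq_getElem?, List.getElem?_eq_getElem (by omega)] at this
    simpa using this
  have sq (q : ℤ) : (q.negOnePow : ℤ) * (q.negOnePow : ℤ) = 1 := by
    rw [← Units.val_mul, Int.units_mul_self, Units.val_one]
  refine ⟨h3, antiperiodicExtension_add_length hl, fun k => ?_, fun k m hkm hmk => ?_⟩
  · obtain ⟨q, r, hr, rfl⟩ := exists_eq_mul_add hl k
    rw [antiperiodicExtension_mul_add hl q hr, slopeDet_smul_left]
    by_cases hr' : r + 1 < l.length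
    · rw [add_assoc, ← Nat.cast_succ, antiperiodicExtension_mul_add hl q hr', slopeDet_smul_right,
        ← mul_assoc, sq, one_mul, ← adjacent_iff]
      exact h.chain.getElem r hr'
    · -- the step from `(1,0)` to `-(0,1)`
      obtain rfl : r = l.length - 1 := by omega
      have e : (l.length : ℤ) * q + (l.length - 1 : ℕ) + 1 = l.length * q + (0 : ℕ) + l.length := by
        push_cast [Nat.cast_sub (show 1 ≤ l.length by omega)]; ring
      rw [e, antiperiodicExtension_add_length hl, antiperiodicExtension_mul_add hl q hl, ← smul_neg,
        slopeDet_smul_right, ← mul_assoc, sq, hfirst, hlast]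
      simp [slopeDet, natVec]
  · obtain ⟨q, r, hr, rfl⟩ := exists_eq_mul_add hl k
    obtain ⟨q', s, hs, rfl⟩ := exists_eq_mul_add hl m
    have hpos : ∀ {i j : ℕ} (hi : i < l.length) (hj : j < l.length), i < j →
        0 < slopeDet (natVec l[i]) (natVec l[j]) := fun hi hj hij =>
      (ltQ_iff _ _).1 (List.pairwise_iff_getElem.1 h.pairwise _ _ hi hj hij)
    have hq1 : q ≤ q' := by
      by_contra hq
      have : (l.length : ℤ) * (q' + 1) ≤ l.length * q :=
        mul_le_mul_of_nonneg_left (by omega) (by omega)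
      linarith [show (s : ℤ) < l.length by omega]
    have hq2 : q' ≤ q + 1 := by
      by_contra hq
      have : (l.length : ℤ) * (q + 2) ≤ l.length * q' :=
        mul_le_mul_of_nonneg_left (by omega) (by omega)
      linarith [show (r : ℤ) < l.length by omega]
    rw [antiperiodicExtension_mul_add hl q hr, antiperiodicExtension_mul_add hl q' hs,
      slopeDet_smul_left, slopeDet_smul_right, ← mul_assoc]
    obtain rfl | rfl : q' = q ∨ q' = q + 1 := by omega
    · rw [sq, one_mul]
      exact hpos _ _ (by omega)
    · rw [Int.negOnePow_succ, Units.val_neg, mul_neg, sq, neg_one_mul, ← slopeDet_swap]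
      refine hpos _ _ ?_
      have : (l.length : ℤ) * (q + 1) = l.length * q + l.length := by ring
      omega

namespace IsUnimodularCycle

variable {n : ℕ} {w : ℤ → Fin 2 → ℤ} (h : IsUnimodularCycle n w)
include h

theorem periodic : Function.Periodic w ((2 * n : ℕ) : ℤ) := fun k => by
  rw [show k + ((2 * n : ℕ) : ℤ) = k + n + n by push_cast; ring, h.antiperiodic, h.antiperiodic,
    neg_neg]

theorem ne_zero (k : ℤ) : w k ≠ 0 := fun e => by
  have := h.slopeDet_succ k
  simp [e, slopeDet] at this

theorem ne_neg (k : ℤ) : w k ≠ -w k := fun e => h.ne_zero k (by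
  ext i; have := congrFun e i; simp at this ⊢; omega)

theorem ne_of_lt {k m : ℤ} (h1 : k < m) (h2 : m < k + (2 * n : ℕ)) : w k ≠ w m := fun e => by
  have h3 := slopeDet_self (w k)
  rcases lt_trichotomy m (k + n) with h4 | rfl | h4
  · have := h.slopeDet_pos k m h1 h4
    rw [← e] at this; omega
  · exact h.ne_neg k (by rw [← h.antiperiodic, ← e])
  · have := h.slopeDet_pos (k + n) m h4 (by push_cast at h2; linarith)
    rw [h.antiperiodic, slopeDet_neg_left, ← e] at this; omega

/-- The vector `w m` lies neither strictly between `w k` and `w (k + 1)` nor strictly between their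
negatives. -/
theorem same_sign (k m : ℤ) : (0 ≤ slopeDet (w k) (w m) ∧ 0 ≤ slopeDet (w (k + 1)) (w m)) ∨
    (slopeDet (w k) (w m) ≤ 0 ∧ slopeDet (w (k + 1)) (w m) ≤ 0) := by
  have nonneg : ∀ a b : ℤ, a ≤ b → b ≤ a + n → 0 ≤ slopeDet (w a) (w b) := by
    intro a b h1 h2
    rcases h1.eq_or_lt with rfl | h1
    · rw [slopeDet_self]
    rcases h2.eq_or_lt with rfl | h2
    · rw [h.antiperiodic, slopeDet_neg_right, slopeDet_self, neg_zero]
    · exact (h.slopeDet_pos a b h1 h2).le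
  have h3 := h.three_le
  obtain ⟨q, r, hr, e⟩ := exists_eq_mul_add (n := 2 * n) (by omega) (m - (k + 1))
  obtain ⟨m', rfl, e'⟩ : ∃ m', m' = k + 1 + r ∧ w m = w m' := by
    refine ⟨_, rfl, ?_⟩
    rw [show m = k + 1 + r + q * ((2 * n : ℕ) : ℤ) by linarith]
    exact h.periodic.int_mul q _
  rw [e']
  by_cases hrn : r < n
  · exact .inl ⟨nonneg _ _ (by omega) (by omega), nonneg _ _ (by omega) (by omega)⟩
  · have h1 := nonneg (k + n) (k + 1 + r) (by omega) (by omega)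
    have h2 := nonneg (k + 1 + n) (k + 1 + r) (by omega) (by omega)
    rw [h.antiperiodic, slopeDet_neg_left] at h1 h2
    exact .inr ⟨by omega, by omega⟩

/-- The sequence as a function of the index modulo its period. -/
theorem cast_intCast (m : ℤ) : w ((m : ZMod (2 * n)).cast) = w m := by
  rw [ZMod.coe_intCast]
  conv_rhs => rw [← Int.emod_add_mul_ediv m ((2 * n : ℕ) : ℤ), mul_comm ((2 * n : ℕ) : ℤ)]
  exact (h.periodic.int_mul _ _).symm

end IsUnimodularCycle

/-! ### The Cartan scheme of a cyclic sequence -/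

/-- The entry of the sequence `w` at an index modulo `2 * n`. -/
def cyclicEntry (n : ℕ) (w : ℤ → Fin 2 → ℤ) (k : ZMod (2 * n)) : Fin 2 → ℤ := w (k.cast : ℤ)

/-- The parity of an element of `ℤ/2n`, as an index in `Fin 2`. -/
def parity (n : ℕ) (k : ZMod (2 * n)) : Fin 2 := ZMod.castHom (Dvd.intro n rfl) (ZMod 2) k

theorem parity_zero (n : ℕ) : parity n 0 = 0 := map_zero (ZMod.castHom (Dvd.intro n rfl) (ZMod 2))

theorem parity_add_one (n : ℕ) (k : ZMod (2 * n)) : parity n (k + 1) = parity n k + 1 := by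
  have := map_add (ZMod.castHom (Dvd.intro n rfl : 2 ∣ 2 * n) (ZMod 2)) k 1
  rwa [map_one] at this

theorem fin_two_add_one_add_one (i : Fin 2) : i + 1 + 1 = i := by revert i; decide

theorem fin_two_eq_add_one_of_ne {i j : Fin 2} (h : i ≠ j) : i = j + 1 := by
  revert i j; decide

theorem fin_two_add_one_ne (i : Fin 2) : i + 1 ≠ i := by revert i; decide

theorem parity_sub_one (n : ℕ) (k : ZMod (2 * n)) : parity n (k - 1) = parity n k + 1 := by
  have := parity_add_one n (k - 1)
  rw [sub_add_cancel] at this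
  rw [this, fin_two_add_one_add_one]

/-- The coordinates of a vector in the basis `-w (k - 1)`, `w k` belonging to the object `k`, where
`-w (k - 1)` has the index `parity k`. -/
def chamberCoords (n : ℕ) (w : ℤ → Fin 2 → ℤ) (k : ZMod (2 * n)) :
    (Fin 2 → ℤ) →ₗ[ℤ] (Fin 2 → ℤ) where
  toFun y i := if i = parity n k then slopeDet (cyclicEntry n w k) y
    else slopeDet (cyclicEntry n w (k - 1)) y
  map_add' x y := by
    ext i; simp only [slopeDet_add_right, Pi.add_apply]; split_ifs <;> rfl
  map_smul' r x := by
    ext i; simp only [slopeDet_smul_right, Pi.smul_apply, smul_eq_mul]; split_ifs <;> rfl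

namespace IsUnimodularCycle

variable {n : ℕ} {w : ℤ → Fin 2 → ℤ} (h : IsUnimodularCycle n w)
include h

theorem cyclicEntry_intCast (m : ℤ) : cyclicEntry n w m = w m := h.cast_intCast m

theorem slopeDet_cyclicEntry_succ (k : ZMod (2 * n)) :
    slopeDet (cyclicEntry n w k) (cyclicEntry n w (k + 1)) = 1 := by
  obtain ⟨m, rfl⟩ := ZMod.intCast_surjective k
  rw [← Int.cast_one, ← Int.cast_add, h.cyclicEntry_intCast, h.cyclicEntry_intCast]
  exact h.slopeDet_succ m

theorem slopeDet_cyclicEntry_pred (k : ZMod (2 * n)) :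
    slopeDet (cyclicEntry n w (k - 1)) (cyclicEntry n w k) = 1 := by
  simpa using h.slopeDet_cyclicEntry_succ (k - 1)

theorem slopeDet_cyclicEntry_pos (k : ZMod (2 * n)) :
    0 < slopeDet (cyclicEntry n w (k - 1)) (cyclicEntry n w (k + 1)) := by
  obtain ⟨m, rfl⟩ := ZMod.intCast_surjective k
  rw [← Int.cast_one, ← Int.cast_add, ← Int.cast_sub, h.cyclicEntry_intCast, h.cyclicEntry_intCast]
  have := h.three_le
  exact h.slopeDet_pos _ _ (by omega) (by omega)

theorem cyclicEntry_same_sign (k m : ZMod (2 * n)) :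
    (0 ≤ slopeDet (cyclicEntry n w (k - 1)) (cyclicEntry n w m) ∧
      0 ≤ slopeDet (cyclicEntry n w k) (cyclicEntry n w m)) ∨
    (slopeDet (cyclicEntry n w (k - 1)) (cyclicEntry n w m) ≤ 0 ∧
      slopeDet (cyclicEntry n w k) (cyclicEntry n w m) ≤ 0) := by
  obtain ⟨k, rfl⟩ := ZMod.intCast_surjective k
  obtain ⟨m, rfl⟩ := ZMod.intCast_surjective m
  rw [← Int.cast_one, ← Int.cast_sub]
  simp only [h.cyclicEntry_intCast]
  simpa using h.same_sign (k - 1) m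

theorem cyclicEntry_add_natCast (k : ZMod (2 * n)) :
    cyclicEntry n w (k + n) = -cyclicEntry n w k := by
  obtain ⟨m, rfl⟩ := ZMod.intCast_surjective k
  rw [← Int.cast_natCast, ← Int.cast_add, h.cyclicEntry_intCast, h.cyclicEntry_intCast]
  exact h.antiperiodic m

theorem cyclicEntry_injective : Function.Injective (cyclicEntry n w) := by
  have h3 := h.three_le
  have : NeZero (2 * n) := ⟨by omega⟩
  intro k m e
  by_contra hne
  have hlt (k : ZMod (2 * n)) : 0 ≤ (k.cast : ℤ) ∧ (k.cast : ℤ) < (2 * n : ℕ) := by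
    rw [ZMod.cast_eq_val]
    exact ⟨by positivity, by exact_mod_cast k.val_lt⟩
  have hne' : (k.cast : ℤ) ≠ m.cast := fun e' => hne (by
    rw [← ZMod.intCast_zmod_cast k, e', ZMod.intCast_zmod_cast])
  rcases lt_or_gt_of_ne hne' with h' | h'
  · exact h.ne_of_lt h' (by linarith [(hlt k).1, (hlt m).2]) e
  · exact h.ne_of_lt h' (by linarith [(hlt m).1, (hlt k).2]) e.symm

/-- The Cartan scheme of a cycle `w`. Its `2n` objects are arranged in a circle; the object `k`
corresponds to the basis `-w (k - 1)`, `w k` of the plane, in which `-w (k - 1)` has the index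
`parity k`. The object changes lead to the two neighbours, and the Cartan entries are read off from
`w (k - 1) + w (k + 1) = c • w k`. -/
def cartanScheme : CartanScheme (Fin 2) (ULift.{u} (ZMod (2 * n))) where
  nonempty := ⟨⟨0⟩⟩
  rho i k := if i = parity n k.down then ⟨k.down - 1⟩ else ⟨k.down + 1⟩
  cartan k := Matrix.of fun i j => if i = j then 2 else if i = parity n k.down then
      -slopeDet (cyclicEntry n w (k.down - 1 - 1)) (cyclicEntry n w (k.down - 1 + 1))
    else -slopeDet (cyclicEntry n w (k.down - 1)) (cyclicEntry n w (k.down + 1))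
  isGenCartanMatrix k := by
    have h1 := h.slopeDet_cyclicEntry_pos k.down
    have h2 := h.slopeDet_cyclicEntry_pos (k.down - 1)
    refine ⟨fun i => by simp, fun i j hij => ?_, fun i j hij => ?_⟩
    · simp only [Matrix.of_apply, if_neg hij]
      split_ifs <;> omega
    · simp only [Matrix.of_apply] at hij
      split_ifs at hij <;> omega
  rho_rho i k := by
    obtain ⟨k⟩ := k
    by_cases hi : i = parity n k
    · simp [hi, parity_sub_one]
    · simp [hi, parity_add_one, ← fin_two_eq_add_one_of_ne hi]
  cartan_rho k i j := by
    obtain ⟨k⟩ := k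
    by_cases hi : i = parity n k
    · simp [hi, parity_sub_one]
    · simp [hi, parity_add_one, ← fin_two_eq_add_one_of_ne hi]

end IsUnimodularCycle

/-! ### Coordinates of reflections and positive roots -/

namespace CartanScheme

theorem reflection_apply_self {A : Type*} (C : CartanScheme (Fin 2) A) (i : Fin 2) (a : A)
    (x : Fin 2 → ℤ) : C.reflection i a x i = -x i - C.cartan a i (i + 1) * x (i + 1) := by
  have h2 := (C.isGenCartanMatrix a).diag i
  fin_cases i <;> simp [reflection, simpleRoot] at h2 ⊢ <;> rw [h2] <;> ring

theorem reflection_apply_of_ne {I A : Type*} [Fintype I] [DecidableEq I] (C : CartanScheme I A)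
    {i j : I} (h : j ≠ i) (a : A) (x : I → ℤ) : C.reflection i a x j = x j := by
  simp [reflection, simpleRoot, h]

theorem reflection_reflection {A : Type*} (C : CartanScheme (Fin 2) A) (i : Fin 2) (a : A)
    (x : Fin 2 → ℤ) : C.reflection i (C.rho i a) (C.reflection i a x) = x := by
  ext j
  by_cases h : j = i
  · subst h
    rw [reflection_apply_self, reflection_apply_self,
      C.reflection_apply_of_ne (fin_two_add_one_ne j),
      ← C.cartan_rho]
    ring
  · rw [reflection_apply_of_ne _ h, reflection_apply_of_ne _ h]

end CartanScheme

theorem natVec_injective {I : Type*} : Function.Injective (natVec : (I → ℕ) → I → ℤ) :=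
  fun x y e => by ext i; have := congrFun e i; simpa [natVec] using this

theorem exists_natVec_eq {I : Type*} {x : I → ℤ} (hx : ∀ i, 0 ≤ x i) : ∃ v, natVec v = x :=
  ⟨fun i => (x i).toNat, by ext i; simp [natVec, hx i]⟩

namespace CartanScheme

theorem simpleRoot_mem_realRoots {I A : Type*} [Fintype I] [DecidableEq I] (C : CartanScheme I A)
    (i : I) (a : A) : simpleRoot i ∈ C.realRoots a :=
  ⟨a, LinearMap.id, i, .id, rfl⟩

/-- In rank two, the roots spanned by the two simple roots are all positive roots. -/
theorem ncard_rootsSpannedBy {A : Type*} (R : A → Set (Fin 2 → ℤ)) (a : A) {i j : Fin 2}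
    (hij : i ≠ j) : (rootsSpannedBy R a i j).ncard = (natPart (R a)).ncard := by
  rw [← Set.ncard_image_of_injective _ natVec_injective]
  congr 1
  ext x
  constructor
  · rintro ⟨hx, p, q, rfl⟩
    obtain ⟨v, hv⟩ : ∃ v, natVec v = (p : ℤ) • simpleRoot i + (q : ℤ) • simpleRoot j := by
      refine exists_natVec_eq fun l => ?_
      simp only [simpleRoot, Pi.add_apply, Pi.smul_apply, Pi.single_apply, smul_eq_mul]
      positivity
    exact ⟨v, by rwa [natPart, Set.mem_ofPred_eq, hv], hv⟩
  · rintro ⟨v, hv, rfl⟩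
    refine ⟨hv, v i, v j, ?_⟩
    obtain rfl := fin_two_eq_add_one_of_ne hij
    ext l
    fin_cases j <;> fin_cases l <;> simp [natVec, simpleRoot]

theorem finite_rootsSpannedBy {A : Type*} {R : A → Set (Fin 2 → ℤ)} {a : A} (h : (R a).Finite)
    (i j : Fin 2) : (rootsSpannedBy R a i j).Finite :=
  h.subset fun _ hx => hx.1

end CartanScheme

namespace IsUnimodularCycle

variable {n : ℕ} {w : ℤ → Fin 2 → ℤ} (h : IsUnimodularCycle n w)
include h

/-! ### Real roots of the scheme of a cyclic sequence -/

theorem chamberCoords_injective (k : ZMod (2 * n)) : Function.Injective (chamberCoords n w k) := by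
  intro x y e
  refine eq_of_slopeDet_eq (h.slopeDet_cyclicEntry_pred k) ?_ ?_
  · simpa [chamberCoords, fin_two_add_one_ne] using congrFun e (parity n k + 1)
  · simpa [chamberCoords] using congrFun e (parity n k)

theorem chamberCoords_entry (k : ZMod (2 * n)) :
    chamberCoords n w k (cyclicEntry n w k) = simpleRoot (parity n k + 1) := by
  ext i
  by_cases hi : i = parity n k
  · simp [chamberCoords, hi, slopeDet_self, simpleRoot, (fin_two_add_one_ne _).symm]
  · simp [chamberCoords, h.slopeDet_cyclicEntry_pred, simpleRoot, fin_two_eq_add_one_of_ne hi]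

theorem chamberCoords_neg_entry_pred (k : ZMod (2 * n)) :
    chamberCoords n w k (-cyclicEntry n w (k - 1)) = simpleRoot (parity n k) := by
  ext i
  by_cases hi : i = parity n k
  · simp [-map_neg, chamberCoords, hi, slopeDet_neg_right,
      slopeDet_swap (cyclicEntry n w k) (cyclicEntry n w (k - 1)), h.slopeDet_cyclicEntry_pred,
      simpleRoot]
  · simp [-map_neg, chamberCoords, hi, slopeDet_neg_right, slopeDet_self, simpleRoot]

theorem chamberCoords_surjective (k : ZMod (2 * n)) :
    Function.Surjective (chamberCoords n w k) := by
  intro x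
  refine ⟨x (parity n k) • -cyclicEntry n w (k - 1) + x (parity n k + 1) • cyclicEntry n w k, ?_⟩
  rw [map_add, map_smul, map_smul, h.chamberCoords_entry, h.chamberCoords_neg_entry_pred]
  ext i
  by_cases hi : i = parity n k
  · simp [hi, simpleRoot, (fin_two_add_one_ne _).symm]
  · simp [simpleRoot, fin_two_eq_add_one_of_ne hi]

/-- The reflections are the changes of coordinates between neighbouring bases. -/
theorem reflection_chamberCoords (i : Fin 2) (k : ULift.{u} (ZMod (2 * n))) (y : Fin 2 → ℤ) :
    h.cartanScheme.reflection i k (chamberCoords n w k.down y) =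
      chamberCoords n w (h.cartanScheme.rho i k).down y := by
  obtain ⟨k⟩ := k
  ext j
  by_cases hj : j = i
  · subst hj
    rw [CartanScheme.reflection_apply_self]
    by_cases hi : j = parity n k
    · have e := congrArg (slopeDet · y) (add_eq_slopeDet_smul
        (h.slopeDet_cyclicEntry_pred (k - 1)) (h.slopeDet_cyclicEntry_pred k))
      simp only [slopeDet_add_left, slopeDet_smul_left] at e
      simp [cartanScheme, chamberCoords, hi, (fin_two_add_one_ne _).symm, parity_sub_one]
      linarith
    · have hi' := fin_two_eq_add_one_of_ne hi
      have e := congrArg (slopeDet · y) (add_eq_slopeDet_smul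
        (h.slopeDet_cyclicEntry_pred k) (h.slopeDet_cyclicEntry_succ k))
      simp only [slopeDet_add_left, slopeDet_smul_left] at e
      simp [cartanScheme, chamberCoords, hi', parity_add_one, fin_two_add_one_add_one]
      linarith
  · rw [CartanScheme.reflection_apply_of_ne _ hj]
    by_cases hi : i = parity n k
    · simp [cartanScheme, chamberCoords, hi, parity_sub_one, fin_two_eq_add_one_of_ne hj]
    · have hi' := fin_two_eq_add_one_of_ne hi
      have hj' := fin_two_eq_add_one_of_ne hj
      simp [cartanScheme, chamberCoords, hi', hj', (fin_two_add_one_ne _).symm, parity_add_one,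
        fin_two_add_one_add_one]

/-- The morphisms from `j` to `k` are changes of coordinates. -/
theorem comp_chamberCoords {j k : ULift.{u} (ZMod (2 * n))} {f : (Fin 2 → ℤ) →ₗ[ℤ] (Fin 2 → ℤ)}
    (hf : h.cartanScheme.IsMorphism j k f) (y : Fin 2 → ℤ) :
    f (chamberCoords n w j.down y) = chamberCoords n w k.down y := by
  induction hf with
  | id => rfl
  | step i b f _ ih => rw [LinearMap.comp_apply, ih, h.reflection_chamberCoords]

theorem cartanScheme_simplyConnected : h.cartanScheme.{u}.SimplyConnected := by
  intro k
  rw [Set.encard_eq_one]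
  refine ⟨LinearMap.id, Set.eq_singleton_iff_unique_mem.2 ⟨.id, fun f hf => ?_⟩⟩
  refine LinearMap.ext fun x => ?_
  obtain ⟨y, rfl⟩ := h.chamberCoords_surjective k.down x
  exact h.comp_chamberCoords hf y

theorem cartanScheme_rho_parity_add_one (k : ZMod (2 * n)) :
    h.cartanScheme.{u}.rho (parity n k + 1) ⟨k⟩ = ⟨k + 1⟩ := by
  simp [cartanScheme]

theorem cartanScheme_rho_parity (k : ZMod (2 * n)) :
    h.cartanScheme.{u}.rho (parity n k) ⟨k⟩ = ⟨k - 1⟩ := by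
  simp [cartanScheme]

theorem cartanScheme_connected : h.cartanScheme.{u}.Connected := by
  have h3 := h.three_le
  have : NeZero (2 * n) := ⟨by omega⟩
  have key (j : ZMod (2 * n)) (m : ℕ) : (h.cartanScheme.{u}.homSet ⟨j⟩ ⟨j + m⟩).Nonempty := by
    induction m with
    | zero => exact ⟨LinearMap.id, by
        rw [Nat.cast_zero, add_zero]; exact CartanScheme.IsMorphism.id⟩
    | succ m ih =>
      obtain ⟨f, hf⟩ := ih
      have := CartanScheme.IsMorphism.step (parity n (j + m) + 1) _ _ hf
      rw [h.cartanScheme_rho_parity_add_one, add_assoc, ← Nat.cast_succ] at this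
      exact ⟨_, this⟩
  rintro ⟨j⟩ ⟨k⟩
  simpa using key j (k - j).val

/-- The real roots at `k` are the coordinates of all vectors of the cycle. -/
theorem cartanScheme_realRoots (k : ULift.{u} (ZMod (2 * n))) : h.cartanScheme.realRoots k =
    Set.range fun m => chamberCoords n w k.down (cyclicEntry n w m) := by
  ext x
  constructor
  · rintro ⟨j, f, i, hf, rfl⟩
    by_cases hi : i = parity n j.down
    · refine ⟨j.down - 1 + n, ?_⟩
      simp only [h.cyclicEntry_add_natCast]
      rw [hi, ← h.chamberCoords_neg_entry_pred, h.comp_chamberCoords hf]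
    · refine ⟨j.down, ?_⟩
      rw [fin_two_eq_add_one_of_ne hi, ← h.chamberCoords_entry, h.comp_chamberCoords hf]
  · rintro ⟨m, rfl⟩
    obtain ⟨f, hf⟩ := h.cartanScheme_connected ⟨m⟩ k
    refine ⟨⟨m⟩, f, parity n m + 1, hf, ?_⟩
    rw [← h.chamberCoords_entry, h.comp_chamberCoords hf]

theorem finite_cartanScheme_realRoots (k : ULift.{u} (ZMod (2 * n))) :
    (h.cartanScheme.realRoots k).Finite := by
  have h3 := h.three_le
  have : NeZero (2 * n) := ⟨by omega⟩
  rw [h.cartanScheme_realRoots]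
  exact Set.finite_range _

theorem ncard_cartanScheme_realRoots (k : ULift.{u} (ZMod (2 * n))) :
    (h.cartanScheme.realRoots k).ncard = 2 * n := by
  have hinj : Function.Injective fun m => chamberCoords n w k.down (cyclicEntry n w m) :=
    (h.chamberCoords_injective k.down).comp h.cyclicEntry_injective
  rw [h.cartanScheme_realRoots, ← Set.image_univ, Set.ncard_image_of_injective _ hinj,
    Set.ncard_univ, Nat.card_zmod]

theorem neg_mem_cartanScheme_realRoots {k : ULift.{u} (ZMod (2 * n))} {x : Fin 2 → ℤ}
    (hx : x ∈ h.cartanScheme.realRoots k) : -x ∈ h.cartanScheme.realRoots k := by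
  rw [h.cartanScheme_realRoots] at hx ⊢
  obtain ⟨m, rfl⟩ := hx
  exact ⟨m + n, by simp only [h.cyclicEntry_add_natCast, map_neg]⟩

theorem nonneg_or_nonpos_of_mem_cartanScheme_realRoots {k : ULift.{u} (ZMod (2 * n))}
    {x : Fin 2 → ℤ}
    (hx : x ∈ h.cartanScheme.realRoots k) : (∀ i, 0 ≤ x i) ∨ ∀ i, x i ≤ 0 := by
  rw [h.cartanScheme_realRoots] at hx
  obtain ⟨m, rfl⟩ := hx
  refine (h.cyclicEntry_same_sign k.down m).imp (fun H i => ?_) fun H i => ?_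
  all_goals
    simp only [chamberCoords, LinearMap.coe_mk, AddHom.coe_mk]
    split_ifs
    exacts [H.2, H.1]

theorem cartanScheme_realRoots_eq_union (k : ULift.{u} (ZMod (2 * n))) :
    h.cartanScheme.realRoots k = natVec '' natPart (h.cartanScheme.realRoots k) ∪
      (fun v => -natVec v) '' natPart (h.cartanScheme.realRoots k) := by
  ext x
  constructor
  · intro hx
    rcases h.nonneg_or_nonpos_of_mem_cartanScheme_realRoots hx with h0 | h0
    · obtain ⟨v, rfl⟩ := exists_natVec_eq h0
      exact .inl ⟨v, hx, rfl⟩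
    · obtain ⟨v, hv⟩ := exists_natVec_eq (x := -x) fun i => by simpa using h0 i
      refine .inr ⟨v, ?_, by simp [hv]⟩
      rw [natPart, Set.mem_ofPred_eq, hv]
      exact h.neg_mem_cartanScheme_realRoots hx
  · rintro (⟨v, hv, rfl⟩ | ⟨v, hv, rfl⟩)
    · exact hv
    · exact h.neg_mem_cartanScheme_realRoots hv

/-- A real root is only divisible by units. -/
theorem eq_or_eq_neg_of_smul_mem {k : ULift.{u} (ZMod (2 * n))} {x : Fin 2 → ℤ} {r : ℤ}
    (hx : r • x ∈ h.cartanScheme.realRoots k) : r = 1 ∨ r = -1 := by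
  rw [h.cartanScheme_realRoots] at hx
  obtain ⟨m, hm⟩ := hx
  obtain ⟨y, rfl⟩ := h.chamberCoords_surjective k.down x
  rw [← map_smul] at hm
  have e := h.slopeDet_cyclicEntry_succ m
  rw [h.chamberCoords_injective _ hm, slopeDet_smul_left] at e
  exact Int.isUnit_iff.1 (IsUnit.of_mul_eq_one _ e)

theorem zero_notMem_cartanScheme_realRoots (k : ULift.{u} (ZMod (2 * n))) :
    (0 : Fin 2 → ℤ) ∉ h.cartanScheme.realRoots k := fun h0 => by
  have := h.eq_or_eq_neg_of_smul_mem (k := k) (r := 0) (x := 0) (by simpa using h0)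
  omega

theorem ncard_natPart_cartanScheme_realRoots (k : ULift.{u} (ZMod (2 * n))) :
    (natPart (h.cartanScheme.realRoots k)).ncard = n := by
  have h1 := h.ncard_cartanScheme_realRoots k
  have hfin : (natPart (h.cartanScheme.realRoots k)).Finite :=
    (h.finite_cartanScheme_realRoots k).preimage natVec_injective.injOn
  have hneg : Function.Injective fun v : Fin 2 → ℕ => -natVec v :=
    neg_injective.comp natVec_injective
  rw [h.cartanScheme_realRoots_eq_union, Set.ncard_union_eq ?_ (hfin.image _) (hfin.image _),
    Set.ncard_image_of_injective _ natVec_injective,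
    Set.ncard_image_of_injective _ hneg] at h1
  · omega
  · rw [Set.disjoint_left]
    rintro _ ⟨v, hv, rfl⟩ ⟨v', hv', e⟩
    refine h.zero_notMem_cartanScheme_realRoots k ?_
    have : natVec v = 0 := by
      ext i
      have := congrFun e i
      simp [natVec] at this ⊢
      omega
    rwa [← this]

theorem iterate_rho_rho (k : ULift.{u} (ZMod (2 * n))) {i j : Fin 2} (hij : i ≠ j) :
    (fun x => h.cartanScheme.{u}.rho i (h.cartanScheme.{u}.rho j x))^[n] k = k := by
  obtain ⟨k⟩ := k
  have h2n : (2 : ZMod (2 * n)) * n = 0 := by exact_mod_cast ZMod.natCast_self (2 * n)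
  have hi := fin_two_eq_add_one_of_ne hij
  by_cases hj : j = parity n k
  · have key (m : ℕ) : (fun x => h.cartanScheme.{u}.rho i (h.cartanScheme.{u}.rho j x))^[m] ⟨k⟩ =
        ⟨k - 2 * m⟩ ∧ parity n (k - 2 * m) = j := by
      induction m with
      | zero => simp [hj]
      | succ m ih =>
        have e : parity n (k - 2 * m - 1) = i := by rw [parity_sub_one, ih.2, hi]
        rw [Function.iterate_succ_apply', ih.1,
          show k - 2 * (m + 1 : ℕ) = k - 2 * m - 1 - 1 by push_cast; ring]
        refine ⟨?_, by rw [parity_sub_one, e, hi, fin_two_add_one_add_one]⟩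
        have h1 := h.cartanScheme_rho_parity (k - 2 * m)
        have h2 := h.cartanScheme_rho_parity (k - 2 * m - 1)
        rw [ih.2] at h1
        rw [e] at h2
        rw [h1, h2]
    rw [(key n).1, h2n, sub_zero]
  · have hj := fin_two_eq_add_one_of_ne hj
    have key (m : ℕ) : (fun x => h.cartanScheme.{u}.rho i (h.cartanScheme.{u}.rho j x))^[m] ⟨k⟩ =
        ⟨k + 2 * m⟩ ∧ parity n (k + 2 * m) + 1 = j := by
      induction m with
      | zero => simp [hj]
      | succ m ih =>
        have e : parity n (k + 2 * m + 1) + 1 = i := by rw [parity_add_one, ih.2, hi]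
        rw [Function.iterate_succ_apply', ih.1,
          show k + 2 * (m + 1 : ℕ) = k + 2 * m + 1 + 1 by push_cast; ring]
        refine ⟨?_, by rw [parity_add_one, e, hi, fin_two_add_one_add_one]⟩
        have h1 := h.cartanScheme_rho_parity_add_one (k + 2 * m)
        have h2 := h.cartanScheme_rho_parity_add_one (k + 2 * m + 1)
        rw [ih.2] at h1
        rw [e] at h2
        rw [h1, h2]
    rw [(key n).1, h2n, add_zero]

theorem cartanScheme_hasFiniteRealRootSystem : h.cartanScheme.{u}.HasFiniteRealRootSystem := by
  refine ⟨⟨h.cartanScheme_realRoots_eq_union, fun k i => ?_, fun k i => ?_, fun k i j hij _ => ?_⟩,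
    h.finite_cartanScheme_realRoots⟩
  · have hmem := h.cartanScheme.simpleRoot_mem_realRoots i k
    ext x
    constructor
    · rintro ⟨hx, r, rfl⟩
      rcases h.eq_or_eq_neg_of_smul_mem hx with rfl | rfl <;> simp
    · rintro (rfl | rfl)
      · exact ⟨hmem, 1, by simp⟩
      · exact ⟨h.neg_mem_cartanScheme_realRoots hmem, -1, by simp⟩
  · rw [h.cartanScheme_realRoots, h.cartanScheme_realRoots, ← Set.range_comp]
    congr 1
    ext m : 1
    exact h.reflection_chamberCoords i k _
  · rw [CartanScheme.ncard_rootsSpannedBy _ _ hij, h.ncard_natPart_cartanScheme_realRoots,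
      h.iterate_rho_rho k hij]

end IsUnimodularCycle

/-- The scheme of the cycle that extends `l` has the entries of `l` as positive roots at `0`. -/
theorem IsUnimodularPath.posRoots_cartanScheme {l : List (Fin 2 → ℕ)} (h : IsUnimodularPath l) :
    h.isUnimodularCycle.cartanScheme.{u}.posRoots ⟨0⟩ = {x | x ∈ l} := by
  have hc := h.isUnimodularCycle
  have h3 := h.three_le
  have hl : 0 < l.length := by omega
  have hcoords (y : Fin 2 → ℤ) : chamberCoords l.length (antiperiodicExtension l) 0 y = y := by
    have e0 : cyclicEntry l.length (antiperiodicExtension l) 0 = ![0, 1] := by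
      have := hc.cyclicEntry_intCast 0
      rw [Int.cast_zero] at this
      have hh := h.head
      rw [List.head?_eq_getElem?, List.getElem?_eq_getElem hl] at hh
      rw [this, show (0 : ℤ) = (0 : ℕ) from rfl, antiperiodicExtension_of_lt hl,
        Option.some.inj hh]
      ext i; fin_cases i <;> simp [natVec]
    have e1 : cyclicEntry l.length (antiperiodicExtension l) (-1) = -![1, 0] := by
      have := hc.cyclicEntry_intCast (-1)
      have hh := h.last
      rw [List.getLast?_eq_getElem?, List.getElem?_eq_getElem (by omega)] at hh
      rw [Int.cast_neg, Int.cast_one] at this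
      rw [this, ← neg_inj, ← antiperiodicExtension_add_length hl, neg_neg,
        show (-1 : ℤ) + l.length = (l.length - 1 : ℕ) by omega,
        antiperiodicExtension_of_lt (by omega), Option.some.inj hh]
      ext i; fin_cases i <;> simp [natVec]
    refine vec_ext ?_ ?_ <;> simp [chamberCoords, parity_zero, e0, e1, slopeDet]
  ext x
  simp only [CartanScheme.posRoots, natPart, hc.cartanScheme_realRoots, hcoords, Set.mem_range,
    Set.mem_ofPred_eq]
  constructor
  · rintro ⟨k, hk⟩
    obtain ⟨m, rfl⟩ := ZMod.intCast_surjective k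
    obtain ⟨q, r, hr, rfl⟩ := exists_eq_mul_add hl m
    rw [hc.cyclicEntry_intCast, antiperiodicExtension_mul_add hl q hr] at hk
    rcases Int.units_eq_one_or q.negOnePow with e | e <;> rw [e] at hk
    · have : x = l[r] := natVec_injective (by simpa using hk.symm)
      exact this ▸ List.getElem_mem hr
    · exfalso
      refine hc.ne_zero r ?_
      rw [antiperiodicExtension_of_lt hr]
      ext i
      have := congrFun hk i
      simp [natVec] at this ⊢
      omega
  · intro hx
    obtain ⟨r, hr, rfl⟩ := List.getElem_of_mem hx
    exact ⟨((r : ℤ) : ZMod (2 * l.length)), by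
      rw [hc.cyclicEntry_intCast, antiperiodicExtension_of_lt hr]⟩

theorem IsUnimodularPath.exists_realizes {l : List (Fin 2 → ℕ)} (h : IsUnimodularPath l) :
    ∃ (A : Type u) (C : CartanScheme (Fin 2) A), Realizes C l :=
  ⟨_, h.isUnimodularCycle.cartanScheme, h.isUnimodularCycle.cartanScheme_connected,
    h.isUnimodularCycle.cartanScheme_simplyConnected,
    h.isUnimodularCycle.cartanScheme_hasFiniteRealRootSystem, _, h.posRoots_cartanScheme⟩

/-! ### The walk around an object -/

/-- `y` is the root following the root `u` in ascending direction around the plane: no element of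
`R` lies strictly between the two, or between their negatives. -/
structure IsNext (R : Set (Fin 2 → ℤ)) (u y : Fin 2 → ℤ) : Prop where
  mem : y ∈ R
  slopeDet_eq : slopeDet u y = 1
  same_sign : ∀ x ∈ R, (0 ≤ slopeDet u x ∧ 0 ≤ slopeDet y x) ∨
    (slopeDet u x ≤ 0 ∧ slopeDet y x ≤ 0)

theorem IsNext.unique {R : Set (Fin 2 → ℤ)} {u y z : Fin 2 → ℤ} (hy : IsNext R u y)
    (hz : IsNext R u z) : y = z := by
  have h1 := hy.same_sign z hz.mem
  have h2 := hz.same_sign y hy.mem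
  rw [hz.slopeDet_eq] at h1
  rw [hy.slopeDet_eq, slopeDet_swap] at h2
  refine eq_of_slopeDet_eq hy.slopeDet_eq (hy.slopeDet_eq.trans hz.slopeDet_eq.symm) ?_
  rw [slopeDet_self]
  omega

theorem IsNext.neg {R : Set (Fin 2 → ℤ)} (hR : ∀ x ∈ R, -x ∈ R) {u y : Fin 2 → ℤ}
    (h : IsNext R u y) : IsNext R (-u) (-y) := by
  refine ⟨hR _ h.mem, by rw [slopeDet_neg_left, slopeDet_neg_right, neg_neg, h.slopeDet_eq],
    fun x hx => ?_⟩
  have := h.same_sign x hx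
  rw [slopeDet_neg_left, slopeDet_neg_left]
  omega

/-- The sequence `0, 1, 0, 1, …` of indices. -/
def altIndex : ℕ → Fin 2
  | 0 => 0
  | k + 1 => altIndex k + 1

theorem altIndex_add_two_mul (k m : ℕ) : altIndex (k + 2 * m) = altIndex k := by
  induction m with
  | zero => rfl
  | succ m ih => rw [mul_add, ← add_assoc, altIndex, altIndex, ih, fin_two_add_one_add_one]

namespace CartanScheme

variable {A : Type u} (C : CartanScheme (Fin 2) A) (a : A)

/-- The objects reached from `a` by applying `ρ₁, ρ₀, ρ₁, …`. -/
def walk : ℕ → A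
  | 0 => a
  | k + 1 => C.rho (altIndex k + 1) (walk k)

/-- The morphism to `a` from the `k`-th object of the walk. -/
def walkMap : ℕ → (Fin 2 → ℤ) →ₗ[ℤ] (Fin 2 → ℤ)
  | 0 => LinearMap.id
  | k + 1 => walkMap k ∘ₗ C.reflection (altIndex k + 1) (C.walk a (k + 1))

/-- The real root at `a` passed in the `k`-th step of the walk, starting with `-α₀` for `k = 0`.
The morphism `walkMap k` sends the simple roots to `-walkRoot k` and `walkRoot (k + 1)`. -/
def walkRoot (k : ℕ) : Fin 2 → ℤ := -C.walkMap a k (simpleRoot (altIndex k))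

/-- The vector `walkRoot (k + 1)` as an element of `ℕ₀²`, meaningful if that vector is positive. -/
def walkVec (k : ℕ) : Fin 2 → ℕ := fun i => (C.walkRoot a (k + 1) i).toNat

theorem walkMap_simpleRoot (k : ℕ) :
    C.walkMap a k (simpleRoot (altIndex k)) = -C.walkRoot a k := by
  rw [walkRoot, neg_neg]

theorem walkMap_simpleRoot_add_one (k : ℕ) :
    C.walkMap a k (simpleRoot (altIndex k + 1)) = C.walkRoot a (k + 1) := by
  rw [walkRoot, walkMap, altIndex, LinearMap.comp_apply, reflection_simpleRoot,
    (C.isGenCartanMatrix _).diag, ← map_neg]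
  congr 1
  module

theorem walkMap_apply (k : ℕ) (x : Fin 2 → ℤ) : C.walkMap a k x =
    x (altIndex k + 1) • C.walkRoot a (k + 1) - x (altIndex k) • C.walkRoot a k := by
  rw [← walkMap_simpleRoot_add_one, sub_eq_add_neg, ← smul_neg, ← walkMap_simpleRoot, ← map_smul,
    ← map_smul, ← map_add]
  congr 1
  ext i
  by_cases hi : i = altIndex k
  · simp [hi, simpleRoot, (fin_two_add_one_ne _).symm]
  · simp [simpleRoot, fin_two_eq_add_one_of_ne hi]

theorem walkRoot_zero : C.walkRoot a 0 = ![-1, 0] := by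
  ext i; fin_cases i <;> simp [walkRoot, walkMap, altIndex, simpleRoot]

theorem walkRoot_one : C.walkRoot a 1 = ![0, 1] := by
  rw [← walkMap_simpleRoot_add_one]
  ext i; fin_cases i <;> simp [walkMap, altIndex, simpleRoot]

theorem walkRoot_add_two (k : ℕ) : C.walkRoot a (k + 2) =
    -C.cartan (C.walk a k) (altIndex k + 1) (altIndex k) • C.walkRoot a (k + 1)
      - C.walkRoot a k := by
  rw [← walkMap_simpleRoot_add_one, walkMap, altIndex, fin_two_add_one_add_one,
    LinearMap.comp_apply, reflection_simpleRoot, map_sub, map_smul, walkMap_simpleRoot,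
    walkMap_simpleRoot_add_one, walk, ← C.cartan_rho]
  module

theorem slopeDet_walkRoot_succ (k : ℕ) :
    slopeDet (C.walkRoot a k) (C.walkRoot a (k + 1)) = 1 := by
  induction k with
  | zero => simp [walkRoot_zero, walkRoot_one, slopeDet]
  | succ k ih =>
    rw [walkRoot_add_two, sub_eq_add_neg, slopeDet_add_right, slopeDet_smul_right, slopeDet_self,
      slopeDet_neg_right, slopeDet_swap, ih]
    norm_num

theorem slopeDet_walkRoot_add_two (k : ℕ) : slopeDet (C.walkRoot a k) (C.walkRoot a (k + 2)) =
    -C.cartan (C.walk a k) (altIndex k + 1) (altIndex k) := by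
  rw [walkRoot_add_two, sub_eq_add_neg, slopeDet_add_right, slopeDet_smul_right,
    slopeDet_neg_right, slopeDet_self, slopeDet_walkRoot_succ]
  ring

/-! ### Morphisms of the Weyl groupoid -/

variable {C a}

theorem IsMorphism.comp {b c : A} {f g : (Fin 2 → ℤ) →ₗ[ℤ] (Fin 2 → ℤ)}
    (hg : C.IsMorphism b c g) (hf : C.IsMorphism a b f) : C.IsMorphism a c (g ∘ₗ f) := by
  induction hg with
  | id => exact hf
  | step i d g _ ih => rw [LinearMap.comp_assoc]; exact .step i d _ ih

theorem isMorphism_reflection_rho (i : Fin 2) (b : A) :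
    C.IsMorphism (C.rho i b) b (C.reflection i (C.rho i b)) := by
  have := IsMorphism.step (C := C) i (C.rho i b) _ .id
  rwa [C.rho_rho, LinearMap.comp_id] at this

theorem IsMorphism.exists_inverse {b : A} {f : (Fin 2 → ℤ) →ₗ[ℤ] (Fin 2 → ℤ)}
    (hf : C.IsMorphism a b f) : ∃ g, C.IsMorphism b a g ∧ ∀ x, g (f x) = x := by
  induction hf with
  | id => exact ⟨_, .id, fun _ => rfl⟩
  | step i c f _ ih =>
    obtain ⟨g, hg, hgf⟩ := ih
    exact ⟨_, hg.comp (isMorphism_reflection_rho i c), fun x => by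
      simp [reflection_reflection, hgf]⟩

/-- In a simply connected scheme there is at most one morphism between two objects. -/
theorem SimplyConnected.eq_of_isMorphism (hC : C.SimplyConnected) {b : A}
    {f g : (Fin 2 → ℤ) →ₗ[ℤ] (Fin 2 → ℤ)} (hf : C.IsMorphism a b f) (hg : C.IsMorphism a b g) :
    f = g := by
  have huniq (c : A) {e : (Fin 2 → ℤ) →ₗ[ℤ] (Fin 2 → ℤ)} (he : C.IsMorphism c c e) :
      e = LinearMap.id := by
    obtain ⟨e', he'⟩ := Set.encard_eq_one.1 (hC c)
    have h1 : e ∈ C.homSet c c := he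
    have h2 : LinearMap.id ∈ C.homSet c c := IsMorphism.id
    rw [he'] at h1 h2
    exact h1.trans h2.symm
  obtain ⟨h, hh, hhf⟩ := hf.exists_inverse
  have e1 := huniq _ (hf.comp hh)
  have e2 := huniq _ (hh.comp hg)
  refine LinearMap.ext fun x => ?_
  calc f x = f (h (g x)) := by rw [show h (g x) = x from LinearMap.congr_fun e2 x]
    _ = g x := LinearMap.congr_fun e1 _

variable (C a)

theorem isMorphism_walkMap (k : ℕ) : C.IsMorphism (C.walk a k) a (C.walkMap a k) := by
  induction k with
  | zero => exact .id
  | succ k ih => exact ih.comp (isMorphism_reflection_rho _ _)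

/-! ### Real roots along the walk -/

variable {C a} {R : A → Set (Fin 2 → ℤ)}

theorem IsRootSystem.neg_mem (h : C.IsRootSystem R) {x : Fin 2 → ℤ} (hx : x ∈ R a) : -x ∈ R a := by
  rw [h.pos_neg] at hx ⊢
  rcases hx with ⟨v, hv, rfl⟩ | ⟨v, hv, rfl⟩
  · exact .inr ⟨v, hv, rfl⟩
  · exact .inl ⟨v, hv, by simp⟩

theorem IsRootSystem.nonneg_or_nonpos (h : C.IsRootSystem R) {x : Fin 2 → ℤ} (hx : x ∈ R a) :
    (∀ i, 0 ≤ x i) ∨ ∀ i, x i ≤ 0 := by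
  rw [h.pos_neg] at hx
  rcases hx with ⟨v, hv, rfl⟩ | ⟨v, hv, rfl⟩
  · exact .inl fun i => by simp [natVec]
  · exact .inr fun i => by simp [natVec]

theorem IsRootSystem.eq_of_apply_add_one_eq_zero (h : C.IsRootSystem R) {x : Fin 2 → ℤ}
    (hx : x ∈ R a) {i : Fin 2} (hi : x (i + 1) = 0) : x = simpleRoot i ∨ x = -simpleRoot i := by
  have : x ∈ {x ∈ R a | ∃ k : ℤ, x = k • simpleRoot i} := by
    refine ⟨hx, x i, ?_⟩
    ext j
    by_cases hj : j = i
    · simp [hj, simpleRoot]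
    · simp [fin_two_eq_add_one_of_ne hj, hi, simpleRoot]
  rwa [h.reduced] at this

theorem IsRootSystem.image_walkMap (h : C.IsRootSystem R) (k : ℕ) :
    C.walkMap a k '' R (C.walk a k) = R a := by
  induction k with
  | zero => simp [walkMap, walk]
  | succ k ih =>
    rw [walkMap, LinearMap.coe_comp, Set.image_comp, h.refl]
    conv_lhs => rw [walk, C.rho_rho, ih]

theorem IsRootSystem.exists_walkMap_eq (h : C.IsRootSystem R) (k : ℕ) {x : Fin 2 → ℤ}
    (hx : x ∈ R a) : ∃ z ∈ R (C.walk a k), x = C.walkMap a k z ∧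
      slopeDet (C.walkRoot a k) x = z (altIndex k + 1) ∧
      slopeDet (C.walkRoot a (k + 1)) x = z (altIndex k) := by
  rw [← h.image_walkMap k] at hx
  obtain ⟨z, hz, rfl⟩ := hx
  refine ⟨z, hz, rfl, ?_, ?_⟩
  all_goals
    have e := C.slopeDet_walkRoot_succ a k
    have e' := slopeDet_swap (C.walkRoot a (k + 1)) (C.walkRoot a k)
    rw [walkMap_apply, sub_eq_add_neg, slopeDet_add_right, slopeDet_neg_right, slopeDet_smul_right,
      slopeDet_smul_right, slopeDet_self]
    simp [e, e']

/-- A root is determined up to sign by its direction. -/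
theorem IsRootSystem.eq_or_eq_neg_of_slopeDet_eq_zero (h : C.IsRootSystem R) (k : ℕ)
    {x : Fin 2 → ℤ} (hx : x ∈ R a) (h0 : slopeDet (C.walkRoot a k) x = 0) :
    x = C.walkRoot a k ∨ x = -C.walkRoot a k := by
  obtain ⟨z, hz, rfl, h1, -⟩ := h.exists_walkMap_eq k hx
  rw [h0] at h1
  rcases h.eq_of_apply_add_one_eq_zero hz h1.symm with rfl | rfl
  · exact .inr (C.walkMap_simpleRoot a k)
  · exact .inl (by rw [map_neg, walkMap_simpleRoot, neg_neg])

theorem IsRootSystem.isNext_walkRoot (h : C.IsRootSystem C.realRoots) (k : ℕ) :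
    IsNext (C.realRoots a) (C.walkRoot a k) (C.walkRoot a (k + 1)) := by
  refine ⟨?_, C.slopeDet_walkRoot_succ a k, fun x hx => ?_⟩
  · rw [← h.image_walkMap k, ← walkMap_simpleRoot_add_one]
    exact ⟨_, C.simpleRoot_mem_realRoots _ _, rfl⟩
  · obtain ⟨z, hz, -, h1, h2⟩ := h.exists_walkMap_eq k hx
    rw [h1, h2]
    exact (h.nonneg_or_nonpos hz).imp (fun H => ⟨H _, H _⟩) fun H => ⟨H _, H _⟩

theorem IsRootSystem.walkRoot_mem (h : C.IsRootSystem C.realRoots) (k : ℕ) :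
    C.walkRoot a k ∈ C.realRoots a := by
  cases k with
  | zero => exact h.neg_mem (C.simpleRoot_mem_realRoots _ _)
  | succ k => exact (h.isNext_walkRoot k).mem

theorem slopeDet_vec_one_zero (x : Fin 2 → ℤ) : slopeDet x ![1, 0] = x 1 := by simp [slopeDet]

theorem simpleRoot_zero : (simpleRoot 0 : Fin 2 → ℤ) = ![1, 0] := by
  ext i; fin_cases i <;> simp [simpleRoot]

/-- Before the walk passes `α₀`, the roots it passes are positive. -/
theorem IsRootSystem.walkRoot_nonneg (h : C.IsRootSystem C.realRoots) (k : ℕ)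
    (hk : ∀ j < k, C.walkRoot a (j + 1) ≠ ![1, 0]) :
    (∀ i, 0 ≤ C.walkRoot a (k + 1) i) ∧
      (C.walkRoot a (k + 1) ≠ ![1, 0] → 0 < C.walkRoot a (k + 1) 1) := by
  induction k with
  | zero => rw [zero_add, walkRoot_one]; simp [Fin.forall_fin_two]
  | succ k ih =>
    have hpos := (ih fun j hj => hk j (by omega)).2 (hk k (by omega))
    have hmem : ![1, 0] ∈ C.realRoots a := simpleRoot_zero ▸ C.simpleRoot_mem_realRoots 0 a
    have h1 := (h.isNext_walkRoot (a := a) (k + 1)).same_sign _ hmem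
    simp only [slopeDet_vec_one_zero] at h1
    have h2 : C.walkRoot a (k + 1 + 1) ≠ ![1, 0] → 0 < C.walkRoot a (k + 1 + 1) 1 := by
      intro hne
      by_contra h0
      have h0 : C.walkRoot a (k + 1 + 1) 1 = 0 := by omega
      rcases h.eq_or_eq_neg_of_slopeDet_eq_zero (k + 1 + 1) hmem
        (by rw [slopeDet_vec_one_zero, h0]) with e | e
      · exact hne e.symm
      · have h3 := C.slopeDet_walkRoot_succ a (k + 1)
        rw [← neg_eq_iff_eq_neg] at e
        rw [← e, slopeDet_neg_right, slopeDet_vec_one_zero] at h3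
        omega
    refine ⟨?_, h2⟩
    by_cases hne : C.walkRoot a (k + 1 + 1) = ![1, 0]
    · rw [hne]; simp [Fin.forall_fin_two]
    · exact (h.nonneg_or_nonpos (h.walkRoot_mem (k + 1 + 1))).resolve_right fun H =>
        absurd (H 1) (not_le.2 (h2 hne))

theorem natVec_walkVec {k : ℕ} (hk : ∀ i, 0 ≤ C.walkRoot a (k + 1) i) :
    natVec (C.walkVec a k) = C.walkRoot a (k + 1) := by
  ext i; simp [natVec, walkVec, hk i]

variable (C a) in
/-- In `n` steps the walk makes half a turn: it passes `n` roots, all positive, the last of which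
is `α₀`. -/
structure IsHalfTurn (n : ℕ) : Prop where
  two_le : 2 ≤ n
  walkRoot_eq : C.walkRoot a n = ![1, 0]
  natVec_walkVec : ∀ k < n, natVec (C.walkVec a k) = C.walkRoot a (k + 1)

theorem HasFiniteRealRootSystem.exists_isHalfTurn (h : C.HasFiniteRealRootSystem) (a : A) :
    ∃ n, C.IsHalfTurn a n := by
  classical
  have hex : ∃ k, C.walkRoot a (k + 1) = ![1, 0] := by
    by_contra! hne
    have hv (k : ℕ) := natVec_walkVec (h.1.walkRoot_nonneg (a := a) k fun j _ => hne j).1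
    have hlt : ∀ {i j : ℕ}, i < j → ltQ (C.walkVec a i) (C.walkVec a j) := fun hij =>
      Nat.rel_of_forall_rel_succ_of_lt ltQ (fun k => Adjacent.ltQ
        ((adjacent_iff _ _).2 (by rw [hv, hv, slopeDet_walkRoot_succ]))) hij
    have hinj : Function.Injective fun k => C.walkRoot a (k + 1) := by
      have key {i j : ℕ} (hij : i < j) : C.walkRoot a (i + 1) ≠ C.walkRoot a (j + 1) := fun e => by
        have := (ltQ_iff _ _).1 (hlt hij)
        rw [hv, hv, e, slopeDet_self] at this
        omega
      intro i j e
      by_contra hij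
      rcases lt_or_gt_of_ne hij with hij | hij
      exacts [key hij e, key hij e.symm]
    exact Set.infinite_range_of_injective hinj
      ((h.2 a).subset (Set.range_subset_iff.2 fun k => h.1.walkRoot_mem _))
  refine ⟨Nat.find hex + 1, ?_, Nat.find_spec hex, fun k hk => ?_⟩
  · have : Nat.find hex ≠ 0 := fun e => by
      have := Nat.find_spec hex
      rw [e, zero_add, walkRoot_one] at this
      simpa using congrFun this 0
    omega
  · exact natVec_walkVec (h.1.walkRoot_nonneg k fun j hj => Nat.find_min hex (by omega)).1

end CartanScheme

namespace CartanScheme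

variable {A : Type u} {C : CartanScheme (Fin 2) A} {a : A} {n : ℕ}

/-! ### The positive roots in ascending order -/

theorem IsHalfTurn.isChain (h : C.IsHalfTurn a n) :
    ((List.range n).map (C.walkVec a)).IsChain Adjacent := by
  rw [List.isChain_iff_getElem]
  intro i hi
  simp only [List.length_map, List.length_range] at hi
  simp only [List.getElem_map, List.getElem_range]
  rw [adjacent_iff, h.natVec_walkVec _ (by omega), h.natVec_walkVec _ hi, slopeDet_walkRoot_succ]

theorem IsHalfTurn.pairwise (h : C.IsHalfTurn a n) :
    ((List.range n).map (C.walkVec a)).Pairwise ltQ :=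
  List.isChain_iff_pairwise.1 (h.isChain.imp fun _ _ => Adjacent.ltQ)

theorem IsHalfTurn.ltQ_walkVec (h : C.IsHalfTurn a n) {i j : ℕ} (hij : i < j) (hj : j < n) :
    ltQ (C.walkVec a i) (C.walkVec a j) := by
  have := List.pairwise_iff_getElem.1 h.pairwise i j (by simp; omega) (by simpa) hij
  simpa only [List.getElem_map, List.getElem_range] using this

/-- During half a turn, every positive root is passed: the sign of its determinant with the
passing roots changes. -/
theorem IsHalfTurn.mem_posRoots (h : C.IsHalfTurn a n) (hC : C.IsRootSystem C.realRoots)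
    {x : Fin 2 → ℕ} : x ∈ C.posRoots a ↔ ∃ k < n, C.walkVec a k = x := by
  classical
  constructor
  · intro hx
    have hx : natVec x ∈ C.realRoots a := hx
    have hend : ∃ k, slopeDet (C.walkRoot a (k + 1)) (natVec x) ≤ 0 := by
      refine ⟨n - 1, ?_⟩
      rw [Nat.sub_add_cancel (by have := h.two_le; omega), h.walkRoot_eq, slopeDet_swap,
        slopeDet_vec_one_zero]
      simp [natVec]
    obtain ⟨k, hk0, hmin⟩ : ∃ k, slopeDet (C.walkRoot a (k + 1)) (natVec x) ≤ 0 ∧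
        ∀ j < k, 0 < slopeDet (C.walkRoot a (j + 1)) (natVec x) :=
      ⟨Nat.find hend, Nat.find_spec hend, fun j hj => not_le.1 (Nat.find_min hend hj)⟩
    have hkn : k < n := by
      by_contra hkn
      have := hmin (n - 1) (by have := h.two_le; omega)
      rw [Nat.sub_add_cancel (by have := h.two_le; omega), h.walkRoot_eq, slopeDet_swap,
        slopeDet_vec_one_zero] at this
      simp [natVec] at this
      omega
    have hzero : slopeDet (C.walkRoot a (k + 1)) (natVec x) = 0 := by
      rcases k with - | k
      · refine le_antisymm hk0 ?_
        simp [walkRoot_one, slopeDet, natVec]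
      · have h1 := (hC.isNext_walkRoot (a := a) (k + 1)).same_sign _ hx
        have h2 := hmin k (by omega)
        omega
    refine ⟨k, hkn, natVec_injective ?_⟩
    have hv := h.natVec_walkVec k hkn
    rcases hC.eq_or_eq_neg_of_slopeDet_eq_zero (k + 1) hx hzero with e | e <;> rw [← hv] at e
    · exact e.symm
    · -- two nonnegative vectors that are opposite to each other vanish
      ext i
      have := congrFun e i
      simp [natVec] at this ⊢
      omega
  · rintro ⟨k, hk, rfl⟩
    rw [posRoots, natPart, Set.mem_ofPred_eq, h.natVec_walkVec k hk]
    exact hC.walkRoot_mem _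

theorem IsHalfTurn.nodup (h : C.IsHalfTurn a n) :
    ((List.range n).map (C.walkVec a)).Nodup :=
  h.pairwise.imp fun h e => by subst e; exact lt_irrefl _ h

theorem IsHalfTurn.isAscendingListing (h : C.IsHalfTurn a n) (hC : C.IsRootSystem C.realRoots) :
    IsAscendingListing (C.posRoots a) ((List.range n).map (C.walkVec a)) := by
  refine ⟨?_, h.nodup, h.pairwise.imp fun h => le_of_lt h⟩
  ext x
  simp [h.mem_posRoots hC]

theorem IsHalfTurn.ncard_posRoots (h : C.IsHalfTurn a n) (hC : C.IsRootSystem C.realRoots) :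
    (C.posRoots a).ncard = n := by
  classical
  rw [← (h.isAscendingListing hC).1, ← List.coe_toFinset, Set.ncard_coe_finset,
    List.toFinset_card_of_nodup h.nodup, List.length_map, List.length_range]

/-- The order `leQ` is antisymmetric on the positive roots. -/
theorem IsHalfTurn.eq_of_leQ (h : C.IsHalfTurn a n) (hC : C.IsRootSystem C.realRoots)
    {x y : Fin 2 → ℕ} (hx : x ∈ C.posRoots a) (hy : y ∈ C.posRoots a) (hxy : leQ x y)
    (hyx : leQ y x) : x = y := by
  obtain ⟨i, hi, rfl⟩ := (h.mem_posRoots hC).1 hx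
  obtain ⟨j, hj, rfl⟩ := (h.mem_posRoots hC).1 hy
  rcases lt_trichotomy i j with hij | rfl | hij
  · exact absurd hyx (not_le.2 (h.ltQ_walkVec hij hj))
  · rfl
  · exact absurd hxy (not_le.2 (h.ltQ_walkVec hij hi))

theorem IsHalfTurn.eq_of_isAscendingListing (h : C.IsHalfTurn a n)
    (hC : C.IsRootSystem C.realRoots) {l : List (Fin 2 → ℕ)}
    (hl : IsAscendingListing (C.posRoots a) l) : l = (List.range n).map (C.walkVec a) := by
  have hl' := h.isAscendingListing hC
  have hmem (x : Fin 2 → ℕ) : x ∈ l ↔ x ∈ (List.range n).map (C.walkVec a) :=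
    Set.ext_iff.1 (hl.1.trans hl'.1.symm) x
  refine List.Perm.eq_of_pairwise (le := leQ) (fun x y hx hy => ?_) hl.2.2 hl'.2.2
    ((List.perm_ext_iff_of_nodup hl.2.1 hl'.2.1).2 hmem)
  exact h.eq_of_leQ hC (hl.1.subset hx) (hl'.1.subset hy)

/-- For an indecomposable Cartan matrix there is a root between `α₁` and `α₀`. -/
theorem IsHalfTurn.three_le (h : C.IsHalfTurn a n) (hirr : (C.cartan a).IsIndecomposable) :
    3 ≤ n := by
  by_contra hn
  obtain rfl : n = 2 := by have := h.two_le; omega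
  have h2 := C.walkRoot_add_two a 0
  rw [h.walkRoot_eq, walkRoot_one, walkRoot_zero] at h2
  have h10 : C.cartan a 1 0 = 0 := by simpa [walk, altIndex] using congrFun h2 1
  refine hirr ⟨{1}, by simp, ⟨0, by simp⟩, ?_⟩
  rintro i rfl j hj
  obtain rfl : j = 0 := by fin_cases j <;> simp at hj ⊢
  exact ⟨h10, (C.isGenCartanMatrix a).zero _ _ h10⟩

theorem IsHalfTurn.isUnimodularPath (h : C.IsHalfTurn a n) (hn : 3 ≤ n) :
    IsUnimodularPath ((List.range n).map (C.walkVec a)) := by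
  have h0 : C.walkVec a 0 = ![0, 1] := natVec_injective (by
    rw [h.natVec_walkVec 0 (by omega), zero_add, walkRoot_one]
    ext i; fin_cases i <;> simp [natVec])
  have h1 : C.walkVec a (n - 1) = ![1, 0] := natVec_injective (by
    rw [h.natVec_walkVec _ (by omega), Nat.sub_add_cancel (by omega), h.walkRoot_eq]
    ext i; fin_cases i <;> simp [natVec])
  refine ⟨h.isChain, by simpa, ?_, ?_⟩
  · rw [List.head?_eq_getElem?, List.getElem?_map, List.getElem?_range (by omega)]
    simp [h0]
  · rw [List.getLast?_eq_getElem?, List.length_map, List.length_range, List.getElem?_map,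
      List.getElem?_range (by omega)]
    simp [h1]

/-! ### Periodicity of the walk -/

theorem IsHalfTurn.walkRoot_add (h : C.IsHalfTurn a n) (hC : C.IsRootSystem C.realRoots) (k : ℕ) :
    C.walkRoot a (k + n) = -C.walkRoot a k := by
  induction k with
  | zero =>
    rw [zero_add, h.walkRoot_eq, walkRoot_zero]
    ext i; fin_cases i <;> simp
  | succ k ih =>
    have h1 := hC.isNext_walkRoot (a := a) (k + n)
    rw [ih] at h1
    rw [Nat.add_right_comm]
    exact h1.unique ((hC.isNext_walkRoot k).neg fun x => hC.neg_mem)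

theorem IsHalfTurn.modEq_of_walkRoot_eq (h : C.IsHalfTurn a n) (hC : C.IsRootSystem C.realRoots)
    {j k : ℕ} (e : C.walkRoot a (j + 1) = C.walkRoot a (k + 1)) : j ≡ k [MOD 2 * n] := by
  have hn := h.two_le
  have hper : Function.Periodic (fun k => C.walkRoot a (k + 1)) (2 * n) := fun k => by
    simp only
    rw [show k + 2 * n + 1 = k + 1 + n + n by ring, h.walkRoot_add hC, h.walkRoot_add hC, neg_neg]
  have hpos {i : ℕ} (hi : i < n) (x : Fin 2 → ℕ) : C.walkRoot a (i + 1) ≠ -natVec x := fun e => by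
    have h1 := C.slopeDet_walkRoot_succ a (i + 1)
    have : C.walkRoot a (i + 1) = 0 := by
      rw [← h.natVec_walkVec i hi] at e ⊢
      ext l
      have := congrFun e l
      simp [natVec] at this ⊢
      omega
    rw [this] at h1
    simp [slopeDet] at h1
  have hinj {i i' : ℕ} (hi : i < n) (hi' : i' < n)
      (e : C.walkRoot a (i + 1) = C.walkRoot a (i' + 1)) : i = i' := by
    rw [← h.natVec_walkVec i hi, ← h.natVec_walkVec i' hi'] at e
    have e := natVec_injective e
    rcases lt_trichotomy i i' with hlt | hlt | hlt
    · have := h.ltQ_walkVec hlt hi'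
      rw [e] at this
      exact absurd this (lt_irrefl _)
    · exact hlt
    · have := h.ltQ_walkVec hlt hi
      rw [e] at this
      exact absurd this (lt_irrefl _)
  have key {i : ℕ} (hi : n ≤ i) : C.walkRoot a (i + 1) = -C.walkRoot a (i - n + 1) := by
    rw [← h.walkRoot_add hC]; congr 1; omega
  rw [← hper.map_mod_nat j, ← hper.map_mod_nat k] at e
  have hj := Nat.mod_lt j (show 2 * n > 0 by omega)
  have hk := Nat.mod_lt k (show 2 * n > 0 by omega)
  unfold Nat.ModEq
  generalize j % (2 * n) = r at *
  generalize k % (2 * n) = s at *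
  by_cases hr : r < n <;> by_cases hs : s < n
  · exact hinj hr hs e
  · rw [key (i := s) (by omega), ← h.natVec_walkVec (s - n) (by omega)] at e
    exact absurd e (hpos hr _)
  · rw [key (i := r) (by omega), ← h.natVec_walkVec (r - n) (by omega)] at e
    exact absurd e.symm (hpos hs _)
  · rw [key (i := r) (by omega), key (i := s) (by omega), neg_inj] at e
    have := hinj (by omega) (by omega) e
    omega

/-- By the Coxeter relation the walk closes up after a full turn. -/
theorem IsHalfTurn.walk_add (h : C.IsHalfTurn a n) (hC : C.HasFiniteRealRootSystem) (k : ℕ) :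
    C.walk a (k + 2 * n) = C.walk a k := by
  induction k with
  | zero =>
    have h1 := hC.1.coxeter a 0 1 (by decide) (finite_rootsSpannedBy (hC.2 a) 0 1)
    rw [ncard_rootsSpannedBy _ _ (by decide), ← posRoots, h.ncard_posRoots hC.1] at h1
    have key (m : ℕ) : C.walk a (2 * m) = (fun x => C.rho 0 (C.rho 1 x))^[m] a := by
      induction m with
      | zero => rfl
      | succ m ih =>
        have e := altIndex_add_two_mul 0 m
        rw [zero_add] at e
        rw [Function.iterate_succ_apply', ← ih, mul_add, mul_one, walk, walk, altIndex, e]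
        rfl
    rw [zero_add, key, h1, walk]
  | succ k ih =>
    rw [Nat.add_right_comm, walk, ih, altIndex_add_two_mul, walk]

theorem IsHalfTurn.walk_eq_iff (h : C.IsHalfTurn a n) (hC : C.HasFiniteRealRootSystem)
    (hs : C.SimplyConnected) (j k : ℕ) : C.walk a j = C.walk a k ↔ j ≡ k [MOD 2 * n] := by
  constructor
  · intro e
    have hj := C.isMorphism_walkMap a j
    rw [e] at hj
    have e := hs.eq_of_isMorphism hj (C.isMorphism_walkMap a k)
    have h1 := C.walkMap_simpleRoot a j
    have h2 := C.walkMap_simpleRoot_add_one a j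
    by_cases hjk : altIndex j = altIndex k
    · rw [e, hjk, walkMap_simpleRoot_add_one] at h2
      exact h.modEq_of_walkRoot_eq hC.1 h2.symm
    · -- For different parities of `j` and `k` the determinants of the two maps differ
      have hjk := fin_two_eq_add_one_of_ne hjk
      rw [e, hjk, walkMap_simpleRoot_add_one] at h1
      rw [e, hjk, fin_two_add_one_add_one, walkMap_simpleRoot] at h2
      have h3 := C.slopeDet_walkRoot_succ a j
      rw [← h2, ← neg_eq_iff_eq_neg.2 h1, slopeDet_neg_left, slopeDet_neg_right, slopeDet_swap,
        slopeDet_walkRoot_succ] at h3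
      omega
  · intro e
    have hper : Function.Periodic (C.walk a) (2 * n) := h.walk_add hC
    rw [← hper.map_mod_nat j, e, hper.map_mod_nat]

/-- The walk passes all objects. -/
theorem IsHalfTurn.exists_walk_eq (h : C.IsHalfTurn a n) (hC : C.HasFiniteRealRootSystem)
    (hconn : C.Connected) (b : A) : ∃ k, C.walk a (k + 1) = b := by
  have hn := h.two_le
  have hshift (k : ℕ) : C.walk a (k + 2 * n - 1 + 1) = C.walk a k := by
    rw [Nat.sub_add_cancel (by omega), h.walk_add hC]
  obtain ⟨f, hf⟩ := hconn a b
  replace hf : C.IsMorphism a b f := hf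
  induction hf with
  | id => exact ⟨_, hshift 0⟩
  | step i b f _ ih =>
    obtain ⟨k, rfl⟩ := ih
    by_cases hi : i = altIndex (k + 1)
    · refine ⟨_, (hshift k).trans ?_⟩
      rw [hi, altIndex, walk, C.rho_rho]
    · exact ⟨k + 1, by rw [fin_two_eq_add_one_of_ne hi, walk]⟩

end CartanScheme

/-! ### Uniqueness and the theorem -/

/-- A connected simply connected scheme is determined by the roots at an object: these determine
the vectors passed by the walk, hence the Cartan entries and the number of objects. -/
theorem CartanScheme.equivalent_of_realRoots_eq {A : Type u} {A' : Type v}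
    {C : CartanScheme (Fin 2) A} {C' : CartanScheme (Fin 2) A'} (hconn : C.Connected)
    (hconn' : C'.Connected) (hs : C.SimplyConnected) (hs' : C'.SimplyConnected)
    (hC : C.HasFiniteRealRootSystem) (hC' : C'.HasFiniteRealRootSystem) {a : A} {a' : A'}
    (hR : C.realRoots a = C'.realRoots a') : C.Equivalent C' := by
  obtain ⟨n, hn⟩ := hC.exists_isHalfTurn a
  obtain ⟨n', hn'⟩ := hC'.exists_isHalfTurn a'
  obtain rfl : n = n' := by
    rw [← hn.ncard_posRoots hC.1, ← hn'.ncard_posRoots hC'.1, posRoots, posRoots, hR]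
  have hroot (k : ℕ) : C.walkRoot a k = C'.walkRoot a' k := by
    induction k with
    | zero => rw [walkRoot_zero, walkRoot_zero]
    | succ k ih =>
      have h1 := hC.1.isNext_walkRoot (a := a) k
      rw [ih, hR] at h1
      exact h1.unique (hC'.1.isNext_walkRoot k)
  have hcartan (k : ℕ) : C.cartan (C.walk a k) (altIndex k + 1) (altIndex k) =
      C'.cartan (C'.walk a' k) (altIndex k + 1) (altIndex k) := by
    rw [← neg_inj, ← slopeDet_walkRoot_add_two, hroot, hroot, slopeDet_walkRoot_add_two]
  choose idx hidx using hn.exists_walk_eq hC hconn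
  have hwalk (j k : ℕ) : C.walk a j = C.walk a k ↔ C'.walk a' j = C'.walk a' k := by
    rw [hn.walk_eq_iff hC hs, hn'.walk_eq_iff hC' hs']
  let g : A → A' := fun b => C'.walk a' (idx b + 1)
  have hg (k : ℕ) : g (C.walk a k) = C'.walk a' k := (hwalk _ _).1 (hidx _)
  have hbij : Function.Bijective g := by
    constructor
    · intro b c e
      rw [← hidx b, ← hidx c] at e ⊢
      rw [hg, hg] at e
      exact (hwalk _ _).2 e
    · intro b
      obtain ⟨k, rfl⟩ := hn'.exists_walk_eq hC' hconn' b
      exact ⟨_, hg _⟩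
  refine ⟨Equiv.refl _, Equiv.ofBijective g hbij, fun i b => ?_, fun b i j => ?_⟩
  · simp only [Equiv.ofBijective_apply, Equiv.refl_apply]
    obtain ⟨k, rfl⟩ := hn.exists_walk_eq hC hconn b
    rw [hg]
    by_cases hi : i = altIndex (k + 1)
    · rw [hi, altIndex, walk, walk, C.rho_rho, C'.rho_rho, hg]
    · rw [fin_two_eq_add_one_of_ne hi, ← walk, ← walk, hg]
  · simp only [Equiv.ofBijective_apply, Equiv.refl_apply]
    obtain ⟨k, rfl⟩ := hn.exists_walk_eq hC hconn b
    rw [hg]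
    by_cases hij : i = j
    · rw [hij, (C.isGenCartanMatrix _).diag, (C'.isGenCartanMatrix _).diag]
    obtain rfl := fin_two_eq_add_one_of_ne (Ne.symm hij)
    by_cases hi : i = altIndex (k + 1)
    · -- the row of the wall between the objects `k` and `k + 1`
      rw [hi, altIndex, fin_two_add_one_add_one, walk, walk, ← C.cartan_rho, ← C'.cartan_rho,
        hcartan]
    · rw [fin_two_eq_add_one_of_ne hi, fin_two_add_one_add_one, hcartan]

theorem CartanScheme.IsRootSystem.realRoots_eq_of_posRoots_eq {A : Type u} {A' : Type v}
    {C : CartanScheme (Fin 2) A} {C' : CartanScheme (Fin 2) A'} (h : C.IsRootSystem C.realRoots)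
    (h' : C'.IsRootSystem C'.realRoots) {a : A} {a' : A'} (e : C.posRoots a = C'.posRoots a') :
    C.realRoots a = C'.realRoots a' := by
  rw [h.pos_neg, h'.pos_neg, ← CartanScheme.posRoots, ← CartanScheme.posRoots, e]

theorem proposition3p7 :
    (∀ f : List (Fin 2 → ℕ), IsFSequence f →
      (∃ (A : Type u) (C : CartanScheme (Fin 2) A), Realizes C f) ∧
      (∀ (A : Type u) (A' : Type v) (C : CartanScheme (Fin 2) A) (C' : CartanScheme (Fin 2) A'),
        Realizes C f → Realizes C' f → C.Equivalent C')) ∧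
    (∀ (A : Type u) (C : CartanScheme (Fin 2) A),
      C.HasFiniteRealRootSystem → C.Irreducible → ∀ a : A,
        (∃! l, IsAscendingListing (C.posRoots a) l) ∧
        ∀ l, IsAscendingListing (C.posRoots a) l → IsFSequence l) := by
  refine ⟨fun f hf => ⟨hf.isUnimodularPath.exists_realizes, ?_⟩, fun A C hC hirr a => ?_⟩
  · rintro A A' C C' ⟨hconn, hs, hC, a, ha⟩ ⟨hconn', hs', hC', a', ha'⟩
    exact CartanScheme.equivalent_of_realRoots_eq hconn hconn' hs hs' hC hC'
      (hC.1.realRoots_eq_of_posRoots_eq hC'.1 (ha.trans ha'.symm))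
  · obtain ⟨n, hn⟩ := hC.exists_isHalfTurn a
    refine ⟨⟨_, hn.isAscendingListing hC.1, fun l => hn.eq_of_isAscendingListing hC.1⟩,
      fun l hl => ?_⟩
    rw [hn.eq_of_isAscendingListing hC.1 hl]
    exact (hn.isUnimodularPath (hn.three_le (hirr a))).isFSequence
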